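/- Let $\varphi=\frac{1+\sqrt5}{2}$. A \emph{half tile} is a closed triangle with named vertices $(a,b,c)$, of one of the following kinds, in any position and of any size: a \emph{half kite} (angle $36^\circ$ at $b$, $72^\circ$ at $a,c$), a \emph{half dart} ($108^\circ$ at $b$, $36^\circ$ at $a,c$), a \emph{half thin rhomb} ($36^\circ$ at $a$, $72^\circ$ at $b,c$), a \emph{half thick rhomb} ($108^\circ$ at $a$, $36^\circ$ at $b,c$). Write $[x,y]_\varphi = x+\varphi^{-1}(y-x)$. The Penrose substitution dissects a half tile $(a,b,c)$ into half tiles smaller by the factor $\varphi$ as follows. - Half kite, with $q=[a,b]_\varphi$, $r=[b,c]_\varphi$: the half dart $(r,q,b)$ and the half kites $(q,a,r)$, $(c,a,r)$. - Half dart, with $p=[c,a]_\varphi$: the half dart $(b,p,a)$ and the half kite $(p,c,b)$. - Half thin rhomb, with $p=[a,b]_\varphi$: the half thin rhomb $(c,p,b)$ and the half thick rhomb $(p,c,a)$. - Half thick rhomb, with $q=[b,a]_\varphi$, $r=[b,c]_\varphi$: the half thick rhombs $(r,c,a)$, $(q,r,b)$ and the half thin rhomb $(r,q,a)$. A \emph{Penrose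 tiling by half tiles} is a set $\sigma$ of half tiles that cover $\mathbb R^2$ and have pairwise disjoint interiors, such that every finite subset of $\sigma$ is contained in the set of half tiles obtained from some single half tile by applying the substitution $m$ times, for some $m\ge 0$. A \emph{Penrose tiling} $\tau$ is either the set of triangles of such a $\sigma$ (Robinson triangles), or the set of all unions of two distinct half tiles of $\sigma$ of the same kind with the same vertex $b$ and the same vertex $c$ (this is a tiling by kites and darts, or by thin and thick rhombs). For a tiling $\tau$ of the plane let $f_\tau:\mathbb R^2\to\mathbb R$ be given by $f_\tau(x)=1/|T|$ if $x$ lies in the interior of a tile $T$ of $\tau$, where $|T|$ is the area of $T$, and $f_\tau(x)=0$ if $x$ lies in the interior of no tile. Corollary 1.5. For every Penrose tiling $\tau$ there is a homeomorphism $\phi:\mathbb R^2\to\mathbb R^2$ such that $\phi$ and $\phi^{-1}$ are Lipschitz, and for almost every $x$ the map $\phi$ is differentiable at $x$ with $\det D_\phi(x)=f_\tau(x)$. -/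

import Mathlib

noncomputable section

namespace Penrose

open MeasureTheory
open scoped goldenRatio

/-- The Euclidean plane. -/
abbrev Plane : Type := EuclideanSpace ℝ (Fin 2)

/-- The function of a family `τ` of planar regions: on the interior of a tile `T` its value is
`1 / area T`, and it vanishes outside the interiors of the tiles. (If the interiors of the tiles
are pairwise disjoint, the tile that is chosen is the only one.) -/
def tilingFun (τ : Set (Set Plane)) (x : Plane) : ℝ :=
  open Classical in
  if h : ∃ T ∈ τ, x ∈ interior T then 1 / (volume h.choose).toReal else 0

/-- The four kinds of half tiles (Robinson triangles): halves of kites and darts, and halves of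
thin and thick rhombs. -/
inductive Kind : Type
  | halfKite
  | halfDart
  | halfThin
  | halfThick

/-- A half tile: a triangle with named vertices. In each kind the side `[b, c]` is the
axis along which the tile (kite, dart or rhomb) was cut into its two mirror halves. -/
@[ext]
structure HalfTile : Type where
  kind : Kind
  a : Plane
  b : Plane
  c : Plane

namespace HalfTile

/-- The closed triangle that a half tile occupies. -/
def region (t : HalfTile) : Set Plane := convexHull ℝ {t.a, t.b, t.c}

/-- The shapes of the half tiles, up to congruence and scale.
* half kite: angle 36° at `b`, angles 72° at `a` and `c`;
* half dart: angle 108° at `b`, angles 36° at `a` and `c`;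
* half of a thin rhomb: angle 36° at `a`, angles 72° at `b` and `c`;
* half of a thick rhomb: angle 108° at `a`, angles 36° at `b` and `c`. -/
def IsWellShaped : HalfTile → Prop
  | ⟨.halfKite, a, b, c⟩ => 0 < dist a c ∧ dist b a = φ * dist a c ∧ dist b c = φ * dist a c
  | ⟨.halfDart, a, b, c⟩ => 0 < dist b a ∧ dist b c = dist b a ∧ dist a c = φ * dist b a
  | ⟨.halfThin, a, b, c⟩ => 0 < dist b c ∧ dist a b = φ * dist b c ∧ dist a c = φ * dist b c
  | ⟨.halfThick, a, b, c⟩ => 0 < dist a b ∧ dist a c = dist a b ∧ dist b c = φ * dist a b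

/-- The point of the segment `[x, y]` at distance `|y - x| / φ` from `x`. -/
def cut (x y : Plane) : Plane := AffineMap.lineMap x y (φ⁻¹ : ℝ)

/-- The Penrose substitution: the dissection of a half tile into half tiles that are smaller
by the factor `φ`. -/
def children : HalfTile → List HalfTile
  | ⟨.halfKite, a, b, c⟩ =>
      [⟨.halfDart, cut b c, cut a b, b⟩, ⟨.halfKite, cut a b, a, cut b c⟩,
        ⟨.halfKite, c, a, cut b c⟩]
  | ⟨.halfDart, a, b, c⟩ =>
      [⟨.halfDart, b, cut c a, a⟩, ⟨.halfKite, cut c a, c, b⟩]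
  | ⟨.halfThin, a, b, c⟩ =>
      [⟨.halfThin, c, cut a b, b⟩, ⟨.halfThick, cut a b, c, a⟩]
  | ⟨.halfThick, a, b, c⟩ =>
      [⟨.halfThick, cut b c, c, a⟩, ⟨.halfThick, cut b a, cut b c, b⟩,
        ⟨.halfThin, cut b c, cut b a, a⟩]

/-- The half tiles that are obtained from `t` by applying the substitution `m` times. -/
def descendants (t : HalfTile) : ℕ → Set HalfTile
  | 0 => {t}
  | m + 1 => {u | ∃ s ∈ t.descendants m, u ∈ s.children}

end HalfTile

/-- A Penrose tiling by half tiles, that is, a tiling of the plane in the substitution tiling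
space of the Penrose substitution: the half tiles cover the plane, have pairwise disjoint
interiors, and each finite patch is part of the `m`-fold substitution of one half tile. -/
structure IsHalfTileTiling (σ : Set HalfTile) : Prop where
  cover : ⋃ t ∈ σ, t.region = Set.univ
  disjoint : σ.Pairwise fun t u => Disjoint (interior t.region) (interior u.region)
  patch : ∀ P : Set HalfTile, P ⊆ σ → P.Finite →
    ∃ (s : HalfTile) (m : ℕ), s.IsWellShaped ∧ P ⊆ s.descendants m

/-- The tiling by the triangles themselves. -/
def triangles (σ : Set HalfTile) : Set (Set Plane) :=
  {T | ∃ t ∈ σ, T = t.region}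

/-- The tiling by whole tiles (kites and darts, or thin and thick rhombs): each tile
is the union of two distinct half tiles of the same kind that have the axis `[b, c]` in common. -/
def wholeTiles (σ : Set HalfTile) : Set (Set Plane) :=
  {T | ∃ t ∈ σ, ∃ u ∈ σ, t ≠ u ∧ t.kind = u.kind ∧ t.b = u.b ∧ t.c = u.c ∧
    T = t.region ∪ u.region}

/-- Penrose tilings: by kites and darts, by thin and thick rhombs, or by the Robinson triangles
of either family, in any position and at any scale. -/
def IsPenroseTiling (τ : Set (Set Plane)) : Prop :=
  ∃ σ : Set HalfTile, IsHalfTileTiling σ ∧ (τ = wholeTiles σ ∨ τ = triangles σ)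

end Penrose

end

/-
Every half tile is a golden triangle, and the Penrose substitution is obtained by repeatedly
cutting golden triangles by a cevian that divides a side in the golden ratio. A triangle of level
`n + 2` is cut into one of level `n + 1` and one of level `n`, and those of levels `0` and `1` are
half tiles, so that the number of half tiles in a dissection is a Fibonacci number.

By induction on the level one constructs bi-Lipschitz maps of a golden triangle onto itself that
are affine on the half tiles of its dissection and give them all the same area. The maps of the
two parts agree on the common side, because the action on a side depends only on the way that
side is subdivided, and so they can be glued. The areas of the two parts have the ratio `φ`, while
equal areas of all half tiles require the ratio of two consecutive Fibonacci numbers: a piecewise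
affine map that slides the foot of the cevian corrects this. Its Lipschitz constants tend to `1`
geometrically in the level, so the compositions are bi-Lipschitz uniformly in the level.

Dissected triangles that contain larger and larger patches of the tiling exhaust the plane, and
the limit along an ultrafilter of the normalized maps is the homeomorphism sought. In a tiling by
whole tiles each half tile is completed by its mirror image, so the area of the tile is twice the
area of the half tile.
-/

noncomputable section

namespace Penrose

open MeasureTheory
open scoped goldenRatio NNReal

section BiLipschitz

variable {X Y Z : Type*}

/-- Maps `F` and `G` that restrict to mutually inverse bijections between `S` and `S'`, both of them
Lipschitz with constant `L`. -/
structure BiLipOn [PseudoEMetricSpace X] [PseudoEMetricSpace Y] (L : ℝ≥0) (S : Set X) (S' : Set Y)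
    (F : X → Y) (G : Y → X) : Prop where
  mapsTo : Set.MapsTo F S S'
  mapsTo_symm : Set.MapsTo G S' S
  invOn : Set.InvOn G F S S'
  lipschitz : LipschitzOnWith L F S
  lipschitz_symm : LipschitzOnWith L G S'

namespace BiLipOn

section PseudoEMetricSpace

variable [PseudoEMetricSpace X] [PseudoEMetricSpace Y] [PseudoEMetricSpace Z] {L L' : ℝ≥0}
  {S : Set X} {S' : Set Y} {S'' : Set Z} {F F' : X → Y} {G G' : Y → X}

protected theorem id (S : Set X) : BiLipOn 1 S S id id :=
  ⟨Set.mapsTo_id S, Set.mapsTo_id S, ⟨fun _ _ => rfl, fun _ _ => rfl⟩,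
    LipschitzWith.id.lipschitzOnWith, LipschitzWith.id.lipschitzOnWith⟩

theorem symm (h : BiLipOn L S S' F G) : BiLipOn L S' S G F :=
  ⟨h.mapsTo_symm, h.mapsTo, h.invOn.symm, h.lipschitz_symm, h.lipschitz⟩

theorem weaken (h : BiLipOn L S S' F G) (hL : L ≤ L') : BiLipOn L' S S' F G :=
  { h with lipschitz := h.lipschitz.weaken hL, lipschitz_symm := h.lipschitz_symm.weaken hL }

theorem congr (h : BiLipOn L S S' F G) (hF : Set.EqOn F' F S) (hG : Set.EqOn G' G S') :
    BiLipOn L S S' F' G' where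
  mapsTo := h.mapsTo.congr hF.symm
  mapsTo_symm := h.mapsTo_symm.congr hG.symm
  invOn := ⟨fun x hx => by rw [hF hx, hG (h.mapsTo hx), h.invOn.1 hx],
    fun y hy => by rw [hG hy, hF (h.mapsTo_symm hy), h.invOn.2 hy]⟩
  lipschitz := fun x hx y hy => by rw [hF hx, hF hy]; exact h.lipschitz hx hy
  lipschitz_symm := fun x hx y hy => by rw [hG hx, hG hy]; exact h.lipschitz_symm hx hy

theorem comp {F' : Y → Z} {G' : Z → Y} (h' : BiLipOn L' S' S'' F' G') (h : BiLipOn L S S' F G) :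
    BiLipOn (L' * L) S S'' (F' ∘ F) (G ∘ G') where
  mapsTo := h'.mapsTo.comp h.mapsTo
  mapsTo_symm := h.mapsTo_symm.comp h'.mapsTo_symm
  invOn := h.invOn.comp h'.invOn h.mapsTo h'.mapsTo_symm
  lipschitz := h'.lipschitz.comp h.lipschitz h.mapsTo
  lipschitz_symm := mul_comm L L' ▸ h.lipschitz_symm.comp h'.lipschitz_symm h'.mapsTo_symm

theorem of_homeomorph (e : X ≃ₜ Y) (he : LipschitzWith L e) (he' : LipschitzWith L e.symm)
    (S : Set X) : BiLipOn L S (e '' S) e e.symm where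
  mapsTo := Set.mapsTo_image e S
  mapsTo_symm := by
    rintro _ ⟨x, hx, rfl⟩
    rwa [e.symm_apply_apply]
  invOn := ⟨fun x _ => e.symm_apply_apply x, fun y _ => e.apply_symm_apply y⟩
  lipschitz := he.lipschitzOnWith
  lipschitz_symm := he'.lipschitzOnWith

end PseudoEMetricSpace

theorem ball_subset [PseudoMetricSpace X] [NormedAddCommGroup Y] [NormedSpace ℝ Y] {L : ℝ≥0}
    {S : Set X} {S' : Set Y} {F : X → Y} {G : Y → X} (h : BiLipOn L S S' F G) (hS' : IsClosed S')
    (hG : Set.MapsTo G (frontier S') (frontier S)) {x : X} {R : ℝ} (hR : Metric.ball x R ⊆ S) :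
    Metric.ball (F x) (R / L) ⊆ S' := by
  intro z hz
  have hr : 0 < R / L := Metric.pos_of_mem_ball hz
  have hL : (0 : ℝ) < L := (L.coe_nonneg.lt_or_eq).resolve_right
    fun hL => by rw [← hL, div_zero] at hr; exact hr.false
  have hx : x ∈ Metric.ball x R := Metric.mem_ball_self ((div_pos_iff_of_pos_right hL).1 hr)
  have mem_interior : ∀ y ∈ Metric.ball (F x) (R / L), y ∈ S' → y ∈ interior S' := by
    intro y hy hyS
    by_contra hy'
    refine (hG ⟨subset_closure hyS, hy'⟩).2 (interior_maximal hR Metric.isOpen_ball ?_)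
    calc dist (G y) x = dist (G y) (G (F x)) := by rw [h.invOn.1 (hR hx)]
      _ ≤ L * dist y (F x) := h.lipschitz_symm.dist_le_mul _ hyS _ (h.mapsTo (hR hx))
      _ < R := (lt_div_iff₀' hL).1 hy
  have subset_interior : Metric.ball (F x) (R / L) ⊆ interior S' :=
    (convex_ball (F x) (R / L)).isPreconnected.subset_left_of_subset_union isOpen_interior
      hS'.isOpen_compl (disjoint_compl_right.mono_left interior_subset)
      (fun y hy => or_iff_not_imp_right.2 fun hy' => mem_interior y hy (not_not.1 hy'))
      ⟨F x, Metric.mem_ball_self hr,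
        mem_interior _ (Metric.mem_ball_self hr) (h.mapsTo (hR hx))⟩
  exact interior_subset (subset_interior hz)

end BiLipOn

section Glue

variable [NormedAddCommGroup X] [NormedSpace ℝ X]

theorem exists_mem_segment_inter {A B : Set X} (hA : IsClosed A) (hB : IsClosed B)
    (hAB : Convex ℝ (A ∪ B)) {x y : X} (hx : x ∈ A) (hy : y ∈ B) :
    ∃ z ∈ segment ℝ x y, z ∈ A ∩ B :=
  isPreconnected_closed_iff.1 (convex_segment x y).isPreconnected A B hA hB
    (hAB.segment_subset (Or.inl hx) (Or.inr hy)) ⟨x, left_mem_segment ℝ x y, hx⟩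
    ⟨y, right_mem_segment ℝ x y, hy⟩

theorem lipschitzOnWith_union [PseudoMetricSpace Y] {A B : Set X} {L : ℝ≥0} {F : X → Y}
    (hA : IsClosed A) (hB : IsClosed B) (hAB : Convex ℝ (A ∪ B)) (hFA : LipschitzOnWith L F A)
    (hFB : LipschitzOnWith L F B) : LipschitzOnWith L F (A ∪ B) := by
  have mixed : ∀ x ∈ A, ∀ y ∈ B, dist (F x) (F y) ≤ L * dist x y := by
    intro x hx y hy
    obtain ⟨z, hz, hzA, hzB⟩ := exists_mem_segment_inter hA hB hAB hx hy
    calc dist (F x) (F y) ≤ dist (F x) (F z) + dist (F z) (F y) := dist_triangle _ _ _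
      _ ≤ L * dist x z + L * dist z y :=
          add_le_add (hFA.dist_le_mul x hx z hzA) (hFB.dist_le_mul z hzB y hy)
      _ = L * dist x y := by rw [← mul_add, dist_add_dist_of_mem_segment hz]
  refine LipschitzOnWith.of_dist_le_mul ?_
  rintro x (hx | hx) y (hy | hy)
  · exact hFA.dist_le_mul x hx y hy
  · exact mixed x hx y hy
  · rw [dist_comm, dist_comm x]
    exact mixed y hy x hx
  · exact hFB.dist_le_mul x hx y hy

variable [NormedAddCommGroup Y] [NormedSpace ℝ Y] {A B : Set X} {A' B' : Set Y} {L : ℝ≥0}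

theorem BiLipOn.union {F : X → Y} {G : Y → X} (h₁ : BiLipOn L A A' F G) (h₂ : BiLipOn L B B' F G)
    (hA : IsClosed A) (hB : IsClosed B) (hAB : Convex ℝ (A ∪ B)) (hA' : IsClosed A')
    (hB' : IsClosed B') (hAB' : Convex ℝ (A' ∪ B')) : BiLipOn L (A ∪ B) (A' ∪ B') F G where
  mapsTo := h₁.mapsTo.union_union h₂.mapsTo
  mapsTo_symm := h₁.mapsTo_symm.union_union h₂.mapsTo_symm
  invOn := ⟨Set.eqOn_union.2 ⟨h₁.invOn.1, h₂.invOn.1⟩, Set.eqOn_union.2 ⟨h₁.invOn.2, h₂.invOn.2⟩⟩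
  lipschitz := lipschitzOnWith_union hA hB hAB h₁.lipschitz h₂.lipschitz
  lipschitz_symm := lipschitzOnWith_union hA' hB' hAB' h₁.lipschitz_symm h₂.lipschitz_symm

theorem exists_eqOn_eqOn {α β : Type*} {f g : α → β} {s t : Set α} (h : Set.EqOn f g (s ∩ t)) :
    ∃ F, Set.EqOn F f s ∧ Set.EqOn F g t := by
  classical
  refine ⟨s.piecewise f g, Set.piecewise_eqOn s f g, fun x hx => ?_⟩
  by_cases hs : x ∈ s
  · rw [Set.piecewise_eq_of_mem _ _ _ hs, h ⟨hs, hx⟩]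
  · exact Set.piecewise_eq_of_notMem _ _ _ hs

theorem BiLipOn.glue {F₁ F₂ : X → Y} {G₁ G₂ : Y → X} (h₁ : BiLipOn L A A' F₁ G₁)
    (h₂ : BiLipOn L B B' F₂ G₂) (hF : Set.EqOn F₁ F₂ (A ∩ B)) (hG : Set.EqOn G₁ G₂ (A' ∩ B'))
    (hA : IsClosed A) (hB : IsClosed B) (hAB : Convex ℝ (A ∪ B)) (hA' : IsClosed A')
    (hB' : IsClosed B') (hAB' : Convex ℝ (A' ∪ B')) :
    ∃ F G, BiLipOn L (A ∪ B) (A' ∪ B') F G ∧ Set.EqOn F F₁ A ∧ Set.EqOn F F₂ B := by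
  obtain ⟨F, hFA, hFB⟩ := exists_eqOn_eqOn hF
  obtain ⟨G, hGA, hGB⟩ := exists_eqOn_eqOn hG
  exact ⟨F, G, (h₁.congr hFA hGA).union (h₂.congr hFB hGB) hA hB hAB hA' hB' hAB', hFA, hFB⟩

end Glue

section Limit

open Filter Topology

variable [MetricSpace X] [MetricSpace Y] {ι : Type*}
  {U : Ultrafilter ι} {K : ℝ≥0} {S : ι → Set X} {S' : ι → Set Y} {f : ι → X → Y} {g : ι → Y → X}

theorem exists_lipschitzWith_tendsto [ProperSpace Y] {a : X} {b : Y} (hS : ∀ x, ∀ᶠ i in U, x ∈ S i)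
    (hf : ∀ i, LipschitzOnWith K (f i) (S i)) (hab : ∀ᶠ i in U, f i a = b) :
    ∃ F : X → Y, LipschitzWith K F ∧ ∀ x, Tendsto (fun i => f i x) U (𝓝 (F x)) := by
  have exists_tendsto : ∀ x, ∃ y, Tendsto (fun i => f i x) U (𝓝 y) := by
    intro x
    have bounded : ∀ᶠ i in U, f i x ∈ Metric.closedBall b (K * dist x a) := by
      filter_upwards [hS x, hS a, hab] with i hx ha hi
      exact hi ▸ (hf i).dist_le_mul x hx a ha
    obtain ⟨y, -, hy⟩ := (isCompact_closedBall b (K * dist x a)).ultrafilter_le_nhds'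
      (U.map fun i => f i x) bounded
    exact ⟨y, hy⟩
  choose F hF using exists_tendsto
  refine ⟨F, LipschitzWith.of_dist_le_mul fun x y => ?_, hF⟩
  refine le_of_tendsto ((hF x).dist (hF y)) ?_
  filter_upwards [hS x, hS y] with i hx hy using (hf i).dist_le_mul x hx y hy

theorem leftInverse_of_tendsto {F : X → Y} {G : Y → X} (hS : ∀ x, ∀ᶠ i in U, x ∈ S i)
    (hS' : ∀ y, ∀ᶠ i in U, y ∈ S' i) (h : ∀ i, BiLipOn K (S i) (S' i) (f i) (g i))
    (hF : ∀ x, Tendsto (fun i => f i x) U (𝓝 (F x)))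
    (hG : ∀ y, Tendsto (fun i => g i y) U (𝓝 (G y))) : Function.LeftInverse G F := by
  intro x
  have bound : ∀ᶠ i in U, dist (g i (F x)) x ≤ K * dist (F x) (f i x) := by
    filter_upwards [hS x, hS' (F x)] with i hx hFx
    calc dist (g i (F x)) x = dist (g i (F x)) (g i (f i x)) := by rw [(h i).invOn.1 hx]
      _ ≤ K * dist (F x) (f i x) := (h i).lipschitz_symm.dist_le_mul _ hFx _ ((h i).mapsTo hx)
  have to_zero : Tendsto (fun i => K * dist (F x) (f i x)) U (𝓝 0) := by
    simpa using ((tendsto_const_nhds (x := F x)).dist (hF x)).const_mul (K : ℝ)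
  exact tendsto_nhds_unique (hG (F x)) <| tendsto_iff_dist_tendsto_zero.2 <|
    squeeze_zero' (Eventually.of_forall fun _ => dist_nonneg) bound to_zero

theorem exists_homeomorph_tendsto [ProperSpace X] [ProperSpace Y] {a : X} {b : Y}
    (hS : ∀ x, ∀ᶠ i in U, x ∈ S i) (hS' : ∀ y, ∀ᶠ i in U, y ∈ S' i)
    (h : ∀ i, BiLipOn K (S i) (S' i) (f i) (g i)) (hab : ∀ i, f i a = b) :
    ∃ Φ : X ≃ₜ Y, LipschitzWith K Φ ∧ LipschitzWith K Φ.symm ∧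
      ∀ x, Tendsto (fun i => f i x) U (𝓝 (Φ x)) := by
  have hba : ∀ᶠ i in U, g i b = a := by
    filter_upwards [hS a] with i hi
    rw [← hab i, (h i).invOn.1 hi]
  obtain ⟨F, hFlip, hF⟩ :=
    exists_lipschitzWith_tendsto hS (fun i => (h i).lipschitz) (Eventually.of_forall hab)
  obtain ⟨G, hGlip, hG⟩ := exists_lipschitzWith_tendsto hS' (fun i => (h i).lipschitz_symm) hba
  exact ⟨⟨⟨F, G, leftInverse_of_tendsto hS hS' h hF hG,
    leftInverse_of_tendsto hS' hS (fun i => (h i).symm) hG hF⟩, hFlip.continuous,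
    hGlip.continuous⟩, hFlip, hGlip, hF⟩

end Limit

end BiLipschitz

section Triangle

/-- The determinant of two plane vectors, as a bilinear form. -/
def cross : Plane →ₗ[ℝ] Plane →ₗ[ℝ] ℝ :=
  LinearMap.mk₂ ℝ (fun p q => p 0 * q 1 - p 1 * q 0)
    (fun _ _ _ => by simp only [PiLp.add_apply]; ring)
    (fun _ _ _ => by simp only [PiLp.smul_apply, smul_eq_mul]; ring)
    (fun _ _ _ => by simp only [PiLp.add_apply]; ring)
    (fun _ _ _ => by simp only [PiLp.smul_apply, smul_eq_mul]; ring)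

theorem cross_apply (p q : Plane) : cross p q = p 0 * q 1 - p 1 * q 0 := rfl

theorem norm_sq_eq_coords (p : Plane) : ‖p‖ ^ 2 = p 0 ^ 2 + p 1 ^ 2 := by
  simp [EuclideanSpace.norm_sq_eq, Fin.sum_univ_two]

theorem abs_cross_le (p q : Plane) : |cross p q| ≤ ‖p‖ * ‖q‖ := by
  refine abs_le_of_sq_le_sq ?_ (by positivity)
  rw [mul_pow, norm_sq_eq_coords, norm_sq_eq_coords, cross_apply]
  linarith [sq_nonneg (p 0 * q 0 + p 1 * q 1)]

/-- Twice the signed area of the triangle with vertices `u`, `v`, `w`. -/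
def doubleArea (u v w : Plane) : ℝ := cross (v - u) (w - u)

theorem doubleArea_eq (u v w : Plane) :
    doubleArea u v w = (v 0 - u 0) * (w 1 - u 1) - (v 1 - u 1) * (w 0 - u 0) := rfl

theorem doubleArea_rotate (u v w : Plane) : doubleArea v w u = doubleArea u v w := by
  simp only [doubleArea_eq]; ring

theorem doubleArea_swap (u v w : Plane) : doubleArea v u w = -doubleArea u v w := by
  simp only [doubleArea_eq]; ring

theorem doubleArea_sq (u v w : Plane) :
    4 * doubleArea u v w ^ 2 = 4 * dist u v ^ 2 * dist u w ^ 2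
      - (dist u v ^ 2 + dist u w ^ 2 - dist v w ^ 2) ^ 2 := by
  simp only [dist_eq_norm, norm_sq_eq_coords, doubleArea_eq, PiLp.sub_apply]
  ring

/-- The barycentric coordinate at the vertex `u` of the triangle `u v w`. -/
def bary (u v w : Plane) : Plane →ᵃ[ℝ] ℝ :=
  ((doubleArea u v w)⁻¹ • cross (w - v)).toAffineMap.comp (AffineMap.id ℝ Plane -ᵥ .const ℝ _ v)

theorem bary_linear (u v w : Plane) :
    (bary u v w).linear = (doubleArea u v w)⁻¹ • cross (w - v) := by
  ext; simp [bary]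

/-- The closed triangle with vertices `u`, `v`, `w`. -/
def triangle (u v w : Plane) : Set Plane := convexHull ℝ {u, v, w}

theorem convex_triangle (u v w : Plane) : Convex ℝ (triangle u v w) := convex_convexHull ℝ _

theorem isCompact_triangle (u v w : Plane) : IsCompact (triangle u v w) :=
  (Set.toFinite _).isCompact_convexHull ℝ

theorem isClosed_triangle (u v w : Plane) : IsClosed (triangle u v w) :=
  (isCompact_triangle u v w).isClosed

theorem triangle_rotate (u v w : Plane) : triangle v w u = triangle u v w := by
  rw [triangle, triangle, Set.insert_comm u v, Set.pair_comm w u]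

theorem triangle_swap (u v w : Plane) : triangle v u w = triangle u v w := by
  rw [triangle, triangle, Set.insert_comm]

variable {u v w : Plane}

theorem bary_apply (x : Plane) : bary u v w x = cross (w - v) (x - v) / doubleArea u v w := by
  simp [bary, div_eq_inv_mul]

theorem bary_swap (x : Plane) : bary u w v x = bary u v w x := by
  rw [bary_apply, bary_apply, ← doubleArea_rotate u w v, doubleArea_swap v w u, doubleArea_rotate,
    ← neg_div_neg_eq (cross (w - v) (x - v))]
  congr 1
  simp only [cross_apply, PiLp.sub_apply]
  ring

theorem bary_mid : bary u v w v = 0 := by simp [bary_apply]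

theorem bary_right : bary u v w w = 0 := by rw [← bary_swap, bary_mid]

section Nondegenerate

variable (h : doubleArea u v w ≠ 0)
include h

theorem bary_left : bary u v w u = 1 := by
  rw [bary_apply, show cross (w - v) (u - v) = doubleArea v w u from rfl, doubleArea_rotate,
    div_self h]

theorem bary_add_bary_add_bary (x : Plane) :
    bary u v w x + bary v w u x + bary w u v x = 1 := by
  simp only [bary_apply]
  rw [doubleArea_rotate v w u, doubleArea_rotate u v w, ← add_div, ← add_div, div_eq_one_iff_eq h]
  simp only [cross_apply, doubleArea_eq, PiLp.sub_apply]
  ring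

theorem bary_combination (x : Plane) :
    bary u v w x • u + bary v w u x • v + bary w u v x • w = x := by
  simp only [bary_apply]
  rw [doubleArea_rotate v w u, doubleArea_rotate u v w]
  ext i
  simp only [PiLp.add_apply, PiLp.smul_apply, smul_eq_mul]
  field_simp
  fin_cases i <;>
    (simp only [cross_apply, doubleArea_eq, PiLp.sub_apply, Fin.zero_eta, Fin.mk_one]; ring)

theorem triangle_eq_preimage :
    triangle u v w = bary u v w ⁻¹' Set.Ici 0 ∩ bary v w u ⁻¹' Set.Ici 0 ∩
      bary w u v ⁻¹' Set.Ici 0 := by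
  have h₁ : doubleArea v w u ≠ 0 := by rwa [doubleArea_rotate]
  have h₂ : doubleArea w u v ≠ 0 := by rwa [doubleArea_rotate]
  refine Set.Subset.antisymm (convexHull_min ?_ ?_) ?_
  · rintro x (rfl | rfl | rfl) <;>
      simp [bary_left, bary_mid, bary_right, h, h₁, h₂]
  · exact (((convex_Ici 0).affine_preimage _).inter ((convex_Ici 0).affine_preimage _)).inter
      ((convex_Ici 0).affine_preimage _)
  · rintro x ⟨⟨hu, hv⟩, hw⟩
    have := (convex_triangle u v w).sum_mem (t := Finset.univ)
      (w := ![bary u v w x, bary v w u x, bary w u v x]) (z := ![u, v, w])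
      (by intro i _; fin_cases i <;> assumption)
      (by simpa [Fin.sum_univ_three] using bary_add_bary_add_bary h x)
      (by intro i _; fin_cases i <;> exact subset_convexHull ℝ _ (by simp))
    simpa [Fin.sum_univ_three, bary_combination h] using this

theorem mem_triangle_iff {x : Plane} :
    x ∈ triangle u v w ↔ 0 ≤ bary u v w x ∧ 0 ≤ bary v w u x ∧ 0 ≤ bary w u v x := by
  rw [triangle_eq_preimage h]
  exact and_assoc

theorem interior_bary_preimage_Ici :
    interior (bary u v w ⁻¹' Set.Ici 0) = bary u v w ⁻¹' Set.Ioi 0 := by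
  have surjective : Function.Surjective (bary u v w).linear := by
    refine LinearMap.surjective fun h₀ => one_ne_zero (α := ℝ) ?_
    simpa [bary_left h, bary_mid, h₀] using ((bary u v w).linearMap_vsub u v).symm
  have isOpenMap : IsOpenMap (bary u v w) := (AffineMap.isOpenMap_linear_iff).1 <|
    LinearMap.isOpenMap_of_finiteDimensional _ surjective
  rw [← isOpenMap.preimage_interior_eq_interior_preimage
    (AffineMap.continuous_of_finiteDimensional _), interior_Ici]

theorem mem_interior_triangle_iff {x : Plane} :
    x ∈ interior (triangle u v w) ↔ 0 < bary u v w x ∧ 0 < bary v w u x ∧ 0 < bary w u v x := by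
  rw [triangle_eq_preimage h, interior_inter, interior_inter, interior_bary_preimage_Ici h,
    interior_bary_preimage_Ici (by rwa [doubleArea_rotate]),
    interior_bary_preimage_Ici (by rwa [doubleArea_rotate, doubleArea_rotate])]
  exact and_assoc

theorem interior_triangle_nonempty : (interior (triangle u v w)).Nonempty := by
  refine ⟨AffineMap.lineMap u (AffineMap.lineMap v w (1 / 2 : ℝ)) (2 / 3 : ℝ),
    (mem_interior_triangle_iff h).2 ?_⟩
  have h₁ : doubleArea v w u ≠ 0 := by rwa [doubleArea_rotate]
  have h₂ : doubleArea w u v ≠ 0 := by rwa [doubleArea_rotate]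
  simp only [AffineMap.apply_lineMap, bary_left h, bary_left h₁, bary_left h₂, bary_mid,
    bary_right]
  norm_num [AffineMap.lineMap_apply]

theorem mem_segment_iff {x : Plane} :
    x ∈ segment ℝ v w ↔ x ∈ triangle u v w ∧ bary u v w x = 0 := by
  constructor
  · intro hx
    refine ⟨segment_subset_convexHull (by simp) (by simp) hx, ?_⟩
    obtain ⟨s, -, rfl⟩ := segment_eq_image_lineMap ℝ v w ▸ hx
    rw [AffineMap.apply_lineMap, bary_mid, bary_right, AffineMap.lineMap_same_apply]
  · rintro ⟨hx, hx₀⟩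
    obtain ⟨-, hv, hw⟩ := (mem_triangle_iff h).1 hx
    refine ⟨_, _, hv, hw, ?_, ?_⟩
    · simpa [hx₀] using bary_add_bary_add_bary h x
    · simpa [hx₀] using bary_combination h x

theorem frontier_triangle :
    frontier (triangle u v w) = segment ℝ u v ∪ segment ℝ w u ∪ segment ℝ v w := by
  have h₁ : doubleArea v w u ≠ 0 := by rwa [doubleArea_rotate]
  have h₂ : doubleArea w u v ≠ 0 := by rwa [doubleArea_rotate]
  ext x
  rw [(isClosed_triangle u v w).frontier_eq, Set.mem_sdiff, mem_interior_triangle_iff h,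
    Set.mem_union, Set.mem_union, mem_segment_iff h, mem_segment_iff h₁, mem_segment_iff h₂,
    triangle_rotate v w u, triangle_rotate u v w, mem_triangle_iff h]
  grind

end Nondegenerate

theorem abs_bary_sub_le (x y : Plane) :
    |bary u v w x - bary u v w y| ≤ dist v w / |doubleArea u v w| * dist x y := by
  have hsub : bary u v w x - bary u v w y = (doubleArea u v w)⁻¹ * cross (w - v) (x - y) := by
    rw [← vsub_eq_sub, ← AffineMap.linearMap_vsub, bary_linear]
    rfl
  rw [hsub, abs_mul, abs_inv, inv_mul_eq_div, div_mul_eq_mul_div, dist_comm v, dist_eq_norm,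
    dist_eq_norm x]
  gcongr
  exact abs_cross_le _ _

end Triangle

section Cut

variable {u v w : Plane} {κ κ' : ℝ}

theorem lineMap_coord (x y : Plane) (c : ℝ) (i : Fin 2) :
    (AffineMap.lineMap x y c : Plane) i = x i + c * (y i - x i) := by
  simp [AffineMap.lineMap_apply]; ring

theorem doubleArea_lineMap_left (u v w : Plane) (κ : ℝ) :
    doubleArea u (AffineMap.lineMap u v κ) w = κ * doubleArea u v w := by
  simp only [doubleArea_eq, lineMap_coord]; ring

theorem doubleArea_lineMap_right (u v w : Plane) (κ : ℝ) :
    doubleArea (AffineMap.lineMap u v κ) v w = (1 - κ) * doubleArea u v w := by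
  simp only [doubleArea_eq, lineMap_coord]; ring

variable (h : doubleArea u v w ≠ 0) (hκ : κ ∈ Set.Ioo 0 1)
include h hκ

theorem bary_lineMap_left (x : Plane) :
    bary u (AffineMap.lineMap u v κ) w x =
      (1 - κ) * (bary u v w x / (1 - κ) - bary v w u x / κ) := by
  have hκ₀ := hκ.1.ne'
  have hκ₁ := (sub_pos.2 hκ.2).ne'
  simp only [bary_apply]
  rw [doubleArea_lineMap_left, doubleArea_rotate u v w]
  field_simp
  simp only [cross_apply, PiLp.sub_apply, lineMap_coord]
  ring

theorem bary_lineMap_mid (x : Plane) :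
    bary (AffineMap.lineMap u v κ) w u x = bary v w u x / κ := by
  have hκ₀ := hκ.1.ne'
  simp only [bary_apply]
  rw [doubleArea_rotate u (AffineMap.lineMap u v κ) w, doubleArea_lineMap_left,
    doubleArea_rotate u v w]
  field_simp

theorem bary_lineMap_right (x : Plane) :
    bary w u (AffineMap.lineMap u v κ) x = bary w u v x := by
  have hκ₀ := hκ.1.ne'
  simp only [bary_apply]
  rw [doubleArea_rotate _ w u, doubleArea_rotate u _ w, doubleArea_lineMap_left,
    doubleArea_rotate v w u, doubleArea_rotate u v w]
  field_simp
  simp only [cross_apply, PiLp.sub_apply, lineMap_coord]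
  ring

theorem mem_left_part_iff {x : Plane} :
    x ∈ triangle u (AffineMap.lineMap u v κ) w ↔
      x ∈ triangle u v w ∧ bary v w u x / κ ≤ bary u v w x / (1 - κ) := by
  have hκ₁ := sub_pos.2 hκ.2
  have h' : doubleArea u (AffineMap.lineMap u v κ) w ≠ 0 := by
    rw [doubleArea_lineMap_left]
    exact mul_ne_zero hκ.1.ne' h
  rw [mem_triangle_iff h', mem_triangle_iff h, bary_lineMap_left h hκ, bary_lineMap_mid h hκ,
    bary_lineMap_right h hκ, mul_nonneg_iff_of_pos_left hκ₁, sub_nonneg, le_div_iff₀ hκ.1, zero_mul]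
  refine ⟨fun ⟨hle, hv, hw⟩ => ⟨⟨?_, hv, hw⟩, hle⟩, fun ⟨⟨_, hv, hw⟩, hle⟩ => ⟨hle, hv, hw⟩⟩
  simpa only [le_div_iff₀ hκ₁, zero_mul] using (div_nonneg hv hκ.1.le).trans hle

theorem mem_right_part_iff {x : Plane} :
    x ∈ triangle (AffineMap.lineMap u v κ) v w ↔
      x ∈ triangle u v w ∧ bary u v w x / (1 - κ) ≤ bary v w u x / κ := by
  have h' : doubleArea v u w ≠ 0 := by rwa [doubleArea_swap, neg_ne_zero]
  have hκ' : 1 - κ ∈ Set.Ioo (0 : ℝ) 1 := ⟨sub_pos.2 hκ.2, sub_lt_self 1 hκ.1⟩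
  rw [← triangle_swap, ← AffineMap.lineMap_apply_one_sub, mem_left_part_iff h' hκ', triangle_swap,
    bary_swap, bary_swap (u := v), sub_sub_cancel]

theorem triangle_eq_union :
    triangle u (AffineMap.lineMap u v κ) w ∪ triangle (AffineMap.lineMap u v κ) v w =
      triangle u v w := by
  ext x
  rw [Set.mem_union, mem_left_part_iff h hκ, mem_right_part_iff h hκ, ← and_or_left,
    and_iff_left (le_total _ _)]

theorem parts_inter_subset :
    triangle u (AffineMap.lineMap u v κ) w ∩ triangle (AffineMap.lineMap u v κ) v w ⊆
      segment ℝ w (AffineMap.lineMap u v κ) := by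
  rintro x ⟨hx₁, hx₂⟩
  have hle := ((mem_right_part_iff h hκ).1 hx₂).2
  have h' : doubleArea u (AffineMap.lineMap u v κ) w ≠ 0 := by
    rw [doubleArea_lineMap_left]
    exact mul_ne_zero hκ.1.ne' h
  rw [segment_symm]
  refine (mem_segment_iff h').2 ⟨hx₁, ?_⟩
  rw [bary_lineMap_left h hκ, hle.antisymm ((mem_left_part_iff h hκ).1 hx₁).2, sub_self, mul_zero]

theorem disjoint_interior_parts :
    Disjoint (interior (triangle u (AffineMap.lineMap u v κ) w))
      (interior (triangle (AffineMap.lineMap u v κ) v w)) := by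
  have h' : doubleArea u (AffineMap.lineMap u v κ) w ≠ 0 := by
    rw [doubleArea_lineMap_left]
    exact mul_ne_zero hκ.1.ne' h
  refine Set.disjoint_left.2 fun x hx₁ hx₂ => ?_
  have hpos := ((mem_interior_triangle_iff h').1 hx₁).1
  have hle := ((mem_right_part_iff h hκ).1 (interior_subset hx₂)).2
  rw [bary_lineMap_left h hκ] at hpos
  exact hle.not_gt (sub_pos.1 (pos_of_mul_pos_right hpos (sub_pos.2 hκ.2).le))

end Cut

section AffineWithDet

open Filter Topology

variable {E : Type*} [NormedAddCommGroup E] [NormedSpace ℝ E] {F F' : E → E} {S S' : Set E}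
  {d d' : ℝ}

/-- `F` agrees on `S` with an affine map whose linear part has determinant `d`. -/
def IsAffineOnWithDet (F : E → E) (S : Set E) (d : ℝ) : Prop :=
  ∃ A : E →L[ℝ] E, A.det = d ∧ ∀ x ∈ S, ∀ y ∈ S, F x - F y = A (x - y)

theorem hasFDerivAt_of_sub_eq {A : E →L[ℝ] E} (hF : ∀ x ∈ S, ∀ y ∈ S, F x - F y = A (x - y))
    {x : E} (hx : x ∈ interior S) : HasFDerivAt F A x := by
  refine (A.hasFDerivAt.add_const (F x - A x)).congr_of_eventuallyEq ?_
  filter_upwards [mem_interior_iff_mem_nhds.1 hx] with y hy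
  rw [sub_eq_iff_eq_add.1 (hF y hy x (interior_subset hx)), map_sub]
  abel

namespace IsAffineOnWithDet

theorem differentiableAt_and_det_fderiv (h : IsAffineOnWithDet F S d) {x : E}
    (hx : x ∈ interior S) : DifferentiableAt ℝ F x ∧ (fderiv ℝ F x).det = d := by
  obtain ⟨A, rfl, hF⟩ := h
  have hA := hasFDerivAt_of_sub_eq hF hx
  exact ⟨hA.differentiableAt, by rw [hA.fderiv]⟩

protected theorem id (S : Set E) : IsAffineOnWithDet id S 1 :=
  ⟨.id ℝ E, LinearMap.det_id, fun _ _ _ _ => rfl⟩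

theorem congr (h : IsAffineOnWithDet F S d) (hF : Set.EqOn F' F S) : IsAffineOnWithDet F' S d :=
  let ⟨A, hA, hFA⟩ := h
  ⟨A, hA, fun x hx y hy => by rw [hF hx, hF hy, hFA x hx y hy]⟩

theorem comp (h' : IsAffineOnWithDet F' S' d') (h : IsAffineOnWithDet F S d)
    (hF : Set.MapsTo F S S') : IsAffineOnWithDet (F' ∘ F) S (d' * d) := by
  obtain ⟨A, rfl, hA⟩ := h
  obtain ⟨A', rfl, hA'⟩ := h'
  refine ⟨A'.comp A, LinearMap.det_comp _ _, fun x hx y hy => ?_⟩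
  rw [Function.comp_apply, Function.comp_apply, hA' _ (hF hx) _ (hF hy), hA x hx y hy,
    ContinuousLinearMap.comp_apply]

theorem of_tendsto [FiniteDimensional ℝ E] {ι : Type*} {U : Ultrafilter ι} {f : ι → E → E}
    {D : ι → Set E} {K : ℝ≥0} (hS : (interior S).Nonempty) (hSD : ∀ᶠ i in U, S ⊆ D i)
    (hf : ∀ i, LipschitzOnWith K (f i) (D i)) (hd : ∀ᶠ i in U, IsAffineOnWithDet (f i) S d)
    (hF : ∀ x, Tendsto (fun i => f i x) U (𝓝 (F x))) : IsAffineOnWithDet F S d := by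
  obtain ⟨x₀, hx₀⟩ := hS
  have bounded : ∀ᶠ i in U, ∃ A : E →L[ℝ] E, ‖A‖ ≤ K ∧ A.det = d ∧
      ∀ x ∈ S, ∀ y ∈ S, f i x - f i y = A (x - y) := by
    filter_upwards [hSD, hd] with i hi ⟨A, hA, hfA⟩
    exact ⟨A, (hasFDerivAt_of_sub_eq hfA hx₀).le_of_lipschitzOn
      (mem_interior_iff_mem_nhds.1 hx₀) ((hf i).mono hi), hA, hfA⟩
  obtain ⟨A, hA⟩ := bounded.choice
  have compact : IsCompact (Metric.closedBall (0 : E →L[ℝ] E) K) := isCompact_closedBall _ _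
  obtain ⟨B, -, hB⟩ := compact.ultrafilter_le_nhds' (U.map A)
    (hA.mono fun i hi => mem_closedBall_zero_iff.2 hi.1)
  replace hB : Tendsto A U (𝓝 B) := hB
  refine ⟨B, ?_, fun x hx y hy => ?_⟩
  · refine tendsto_nhds_unique (ContinuousLinearMap.continuous_det.continuousAt.tendsto.comp hB) ?_
    exact tendsto_const_nhds.congr' (hA.mono fun i hi => hi.2.1.symm)
  · refine tendsto_nhds_unique ((hF x).sub (hF y)) ?_
    have lim : Tendsto (fun i => A i (x - y)) U (𝓝 (B (x - y))) :=
      ((ContinuousLinearMap.apply ℝ E (x - y)).continuous.tendsto B).comp hB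
    exact lim.congr' (hA.mono fun i hi => (hi.2.2 x hx y hy).symm)

end IsAffineOnWithDet

theorem exists_homeomorph_smul_sub (p : E) {μ : ℝ} {M : ℝ≥0} (hμ : 0 < μ)
    (hM : μ ≤ M) (hM' : μ⁻¹ ≤ M) :
    ∃ e : E ≃ₜ E, e p = 0 ∧ LipschitzWith M e ∧ LipschitzWith M e.symm ∧
      ∀ S, IsAffineOnWithDet e S (μ ^ Module.finrank ℝ E) := by
  have det_smul_id : (μ • ContinuousLinearMap.id ℝ E).det = μ ^ Module.finrank ℝ E := by
    simp [ContinuousLinearMap.det]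
  refine ⟨(Homeomorph.subRight p).trans (Homeomorph.smulOfNeZero μ hμ.ne'), by simp,
    LipschitzWith.of_dist_le_mul fun x y => ?_, LipschitzWith.of_dist_le_mul fun x y => ?_,
    fun S => ⟨_, det_smul_id, fun x _ y _ => by simp [← smul_sub]⟩⟩
  · simp only [Homeomorph.trans_apply, Homeomorph.subRight_apply, Homeomorph.smulOfNeZero_apply,
      dist_smul₀, dist_sub_right, Real.norm_of_nonneg hμ.le]
    gcongr
  · simp only [Homeomorph.symm_trans_apply, Homeomorph.subRight_symm_apply, dist_add_right,
      Homeomorph.smulOfNeZero_symm_apply, dist_smul₀, norm_inv, Real.norm_of_nonneg hμ.le]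
    gcongr

end AffineWithDet

section Slide

variable {u v w : Plane} {κ κ' : ℝ}

/-- The continuous function on the triangle `u v w` that is affine on the two parts cut off by the
segment from `w` to the point `lineMap u v κ`, equals `1` at this point and vanishes at `u`, `v`,
`w`. -/
def tent (κ : ℝ) (u v w x : Plane) : ℝ := min (bary v w u x / κ) (bary u v w x / (1 - κ))

/-- The map of the triangle `u v w` that is affine on its two parts, fixes the vertices and moves
the point that cuts `[u, v]` in the ratio `κ` to the one that cuts it in the ratio `κ'`. -/
def slide (κ κ' : ℝ) (u v w x : Plane) : Plane := x + ((κ' - κ) * tent κ u v w x) • (v - u)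

theorem tent_swap (x : Plane) : tent (1 - κ) v u w x = tent κ u v w x := by
  rw [tent, tent, sub_sub_cancel, min_comm, bary_swap (u := u), bary_swap (u := v)]

theorem slide_swap (x : Plane) : slide (1 - κ) (1 - κ') v u w x = slide κ κ' u v w x := by
  rw [slide, slide, tent_swap]
  module

theorem tent_eq_iff (hκ : κ ∈ Set.Ioo 0 1) {x : Plane} {t : ℝ} :
    tent κ u v w x = t ↔ κ * t ≤ bary v w u x ∧ (1 - κ) * t ≤ bary u v w x ∧
      (κ * t = bary v w u x ∨ (1 - κ) * t = bary u v w x) := by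
  have hκ₁ := sub_pos.2 hκ.2
  have min_iff (p q : ℝ) : min p q = t ↔ t ≤ p ∧ t ≤ q ∧ (t = p ∨ t = q) := by grind
  rw [tent, min_iff, le_div_iff₀ hκ.1, le_div_iff₀ hκ₁, eq_div_iff hκ.1.ne', eq_div_iff hκ₁.ne',
    mul_comm t, mul_comm t]

theorem slide_eq_of_tent_eq {t : ℝ} {x : Plane} (h : tent κ u v w x = t) :
    slide κ κ' u v w x = x + ((κ' - κ) * t) • (v - u) := by rw [slide, h]

section Nondegenerate

variable (h : doubleArea u v w ≠ 0)
include h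

theorem bary_add_smul_left (x : Plane) (m : ℝ) :
    bary u v w (x + m • (v - u)) = bary u v w x - m := by
  have hvu : (bary u v w).linear (v - u) = -1 := by
    rw [← vsub_eq_sub, AffineMap.linearMap_vsub, bary_mid, bary_left h, vsub_eq_sub, zero_sub]
  rw [add_comm, ← vadd_eq_add, AffineMap.map_vadd, map_smul, hvu, vadd_eq_add, smul_eq_mul]
  ring

theorem bary_add_smul_mid (x : Plane) (m : ℝ) :
    bary v w u (x + m • (v - u)) = bary v w u x + m := by
  have h' : doubleArea v u w ≠ 0 := by rwa [doubleArea_swap, neg_ne_zero]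
  rw [← neg_sub u v, smul_neg, ← neg_smul, bary_swap, bary_add_smul_left h', sub_neg_eq_add,
    bary_swap]

theorem bary_add_smul_right (x : Plane) (m : ℝ) :
    bary w u v (x + m • (v - u)) = bary w u v x := by
  have hsum := bary_add_bary_add_bary h (x + m • (v - u))
  rw [bary_add_smul_left h, bary_add_smul_mid h] at hsum
  linarith [bary_add_bary_add_bary h x]

variable (hκ : κ ∈ Set.Ioo 0 1)
include hκ

theorem tent_slide (hκ' : κ' ∈ Set.Ioo 0 1) (x : Plane) :
    tent κ' u v w (slide κ κ' u v w x) = tent κ u v w x := by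
  obtain ⟨hv, hu, hvu⟩ := (tent_eq_iff hκ).1 (rfl : tent κ u v w x = _)
  rw [tent_eq_iff hκ', slide, bary_add_smul_left h, bary_add_smul_mid h]
  exact ⟨by linarith, by linarith,
    hvu.imp (fun e => by linear_combination e) fun e => by linear_combination e⟩

theorem slide_slide (hκ' : κ' ∈ Set.Ioo 0 1) (x : Plane) :
    slide κ' κ u v w (slide κ κ' u v w x) = x := by
  rw [slide, tent_slide h hκ hκ', slide]
  module

theorem slide_mem_triangle (hκ' : κ' ∈ Set.Ioo 0 1) {x : Plane} (hx : x ∈ triangle u v w) :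
    slide κ κ' u v w x ∈ triangle u v w := by
  obtain ⟨hu, hv, hw⟩ := (mem_triangle_iff h).1 hx
  have ht : 0 ≤ tent κ u v w x :=
    le_min (div_nonneg hv hκ.1.le) (div_nonneg hu (sub_pos.2 hκ.2).le)
  obtain ⟨hv', hu', -⟩ := (tent_eq_iff hκ').1 (tent_slide h hκ hκ' x)
  refine (mem_triangle_iff h).2 ⟨(mul_nonneg (sub_pos.2 hκ'.2).le ht).trans hu',
    (mul_nonneg hκ'.1.le ht).trans hv', ?_⟩
  rwa [slide, bary_add_smul_right h]

theorem isAffineOnWithDet_slide_left : IsAffineOnWithDet (slide κ κ' u v w)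
    (triangle u (AffineMap.lineMap u v κ) w) (κ' / κ) := by
  have hlin : (bary v w u).linear (v - u) = 1 := by
    rw [← vsub_eq_sub, AffineMap.linearMap_vsub, bary_left (by rwa [doubleArea_rotate]),
      bary_right, vsub_eq_sub, sub_zero]
  refine ⟨(LinearMap.transvection (((κ' - κ) / κ) • (bary v w u).linear)
    (v - u)).toContinuousLinearMap, ?_, fun x hx y hy => ?_⟩
  · rw [LinearMap.det_toContinuousLinearMap, LinearMap.transvection.det, LinearMap.smul_apply, hlin,
      smul_eq_mul, mul_one, sub_div, div_self hκ.1.ne', add_sub_cancel]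
  · rw [slide_eq_of_tent_eq (min_eq_left ((mem_left_part_iff h hκ).1 hx).2),
      slide_eq_of_tent_eq (min_eq_left ((mem_left_part_iff h hκ).1 hy).2),
      LinearMap.coe_toContinuousLinearMap', LinearMap.transvection.apply, LinearMap.smul_apply,
      ← vsub_eq_sub x y, AffineMap.linearMap_vsub, vsub_eq_sub, vsub_eq_sub, smul_eq_mul]
    module

theorem isAffineOnWithDet_slide_right : IsAffineOnWithDet (slide κ κ' u v w)
    (triangle (AffineMap.lineMap u v κ) v w) ((1 - κ') / (1 - κ)) := by
  have h' : doubleArea v u w ≠ 0 := by rwa [doubleArea_swap, neg_ne_zero]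
  have left := isAffineOnWithDet_slide_left (κ' := 1 - κ') h' (Set.Ioo.one_sub_mem hκ)
  rw [AffineMap.lineMap_apply_one_sub, triangle_swap] at left
  exact left.congr fun x _ => (slide_swap x).symm

theorem slide_lineMap_left {s : ℝ} (hs : s ≤ 1) :
    slide κ κ' u v w (AffineMap.lineMap u v (κ * s)) = AffineMap.lineMap u v (κ' * s) := by
  have tent_eq : tent κ u v w (AffineMap.lineMap u v (κ * s)) = s := by
    rw [tent_eq_iff hκ, AffineMap.apply_lineMap, AffineMap.apply_lineMap, bary_left h, bary_mid,
      bary_left (by rwa [doubleArea_rotate]), bary_right]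
    simp only [AffineMap.lineMap_apply_ring']
    exact ⟨by linarith, by linarith, Or.inl (by ring)⟩
  rw [slide, tent_eq, AffineMap.lineMap_apply_module', AffineMap.lineMap_apply_module']
  module

theorem slide_lineMap_right {s : ℝ} (hs : 0 ≤ s) :
    slide κ κ' u v w (AffineMap.lineMap u v (κ + (1 - κ) * s)) =
      AffineMap.lineMap u v (κ' + (1 - κ') * s) := by
  have h' : doubleArea v u w ≠ 0 := by rwa [doubleArea_swap, neg_ne_zero]
  have left := slide_lineMap_left (κ' := 1 - κ') h' (Set.Ioo.one_sub_mem hκ) (sub_le_self 1 hs)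
  rw [slide_swap] at left
  rw [← AffineMap.lineMap_apply_one_sub, ← AffineMap.lineMap_apply_one_sub v u]
  convert left using 3 <;> ring

theorem slide_lineMap_apex {s : ℝ} (hs : s ≤ 1) :
    slide κ κ' u v w (AffineMap.lineMap u w s) = AffineMap.lineMap u w s := by
  have tent_eq : tent κ u v w (AffineMap.lineMap u w s) = 0 := by
    rw [tent_eq_iff hκ, AffineMap.apply_lineMap, AffineMap.apply_lineMap, bary_left h, bary_right,
      bary_mid, bary_right]
    simp only [AffineMap.lineMap_apply_ring']
    exact ⟨by linarith, by linarith, Or.inl (by ring)⟩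
  rw [slide, tent_eq, mul_zero, zero_smul, add_zero]

theorem slide_lineMap_apex' {s : ℝ} (hs : s ≤ 1) :
    slide κ κ' u v w (AffineMap.lineMap v w s) = AffineMap.lineMap v w s := by
  have h' : doubleArea v u w ≠ 0 := by rwa [doubleArea_swap, neg_ne_zero]
  rw [← slide_swap]
  exact slide_lineMap_apex h' (Set.Ioo.one_sub_mem hκ) hs

end Nondegenerate

theorem abs_bary_div_sub_le {C : ℝ} (h : doubleArea u v w ≠ 0) (hκ : 1 / 3 ≤ κ)
    (hC : dist u v * dist v w ≤ C * |doubleArea u v w|) (x y : Plane) :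
    |bary u v w x / κ - bary u v w y / κ| * dist u v ≤ 3 * C * dist x y := by
  have harea : 0 < |doubleArea u v w| := abs_pos.2 h
  rw [← sub_div, abs_div, abs_of_nonneg (by linarith : 0 ≤ κ)]
  calc |bary u v w x - bary u v w y| / κ * dist u v
      ≤ dist v w / |doubleArea u v w| * dist x y / (1 / 3) * dist u v := by
        gcongr
        exact abs_bary_sub_le x y
    _ = 3 * (dist u v * dist v w / |doubleArea u v w|) * dist x y := by ring
    _ ≤ 3 * C * dist x y := by
        gcongr
        rwa [div_le_iff₀ harea]

section Lipschitz

variable {C ε : ℝ≥0} (h : doubleArea u v w ≠ 0)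
  (hu : dist u v * dist u w ≤ C * |doubleArea u v w|)
  (hv : dist u v * dist v w ≤ C * |doubleArea u v w|) (hε : |κ' - κ| ≤ ε)
include h hu hv

theorem abs_tent_sub_le (hκ : κ ∈ Set.Icc (1 / 3) (2 / 3)) (x y : Plane) :
    |tent κ u v w x - tent κ u v w y| * dist u v ≤ 3 * C * dist x y := by
  have bound_v : |bary v w u x / κ - bary v w u y / κ| * dist u v ≤ 3 * C * dist x y := by
    rw [bary_swap x, bary_swap y, dist_comm u v]
    refine abs_bary_div_sub_le (by rwa [doubleArea_swap, neg_ne_zero]) hκ.1 ?_ x y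
    rwa [doubleArea_swap, abs_neg, dist_comm v u]
  have bound_u := abs_bary_div_sub_le h (κ := 1 - κ) (by linarith [hκ.2]) hv x y
  refine (mul_le_mul_of_nonneg_right (abs_min_sub_min_le_max _ _ _ _) dist_nonneg).trans ?_
  rw [max_mul_of_nonneg _ _ dist_nonneg]
  exact max_le bound_v bound_u

include hε

theorem lipschitzWith_slide (hκ : κ ∈ Set.Icc (1 / 3) (2 / 3)) :
    LipschitzWith (1 + 3 * C * ε) (slide κ κ' u v w) := by
  refine LipschitzWith.of_dist_le_mul fun x y => ?_
  calc dist (slide κ κ' u v w x) (slide κ κ' u v w y)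
      ≤ dist x y + dist (((κ' - κ) * tent κ u v w x) • (v - u))
          (((κ' - κ) * tent κ u v w y) • (v - u)) := dist_add_add_le _ _ _ _
    _ = dist x y + |κ' - κ| * (|tent κ u v w x - tent κ u v w y| * dist u v) := by
        rw [dist_eq_norm (_ • _), ← sub_smul, ← mul_sub, norm_smul, Real.norm_eq_abs, abs_mul,
          dist_comm u v, dist_eq_norm v u, mul_assoc]
    _ ≤ dist x y + ε * (3 * C * dist x y) := by
        gcongr dist x y + ?_ * ?_
        exact abs_tent_sub_le h hu hv hκ x y
    _ = (1 + 3 * C * ε : ℝ≥0) * dist x y := by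
        push_cast
        ring

theorem biLipOn_slide (hκ : κ ∈ Set.Icc (1 / 3) (2 / 3)) (hκ' : κ' ∈ Set.Icc (1 / 3) (2 / 3)) :
    BiLipOn (1 + 3 * C * ε) (triangle u v w) (triangle u v w) (slide κ κ' u v w)
      (slide κ' κ u v w) := by
  have hsub : Set.Icc (1 / 3 : ℝ) (2 / 3) ⊆ Set.Ioo 0 1 :=
    Set.Icc_subset_Ioo (by norm_num) (by norm_num)
  exact ⟨fun x => slide_mem_triangle h (hsub hκ) (hsub hκ'),
    fun x => slide_mem_triangle h (hsub hκ') (hsub hκ),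
    ⟨fun x _ => slide_slide h (hsub hκ) (hsub hκ') x,
      fun x _ => slide_slide h (hsub hκ') (hsub hκ) x⟩,
    (lipschitzWith_slide h hu hv hε hκ).lipschitzOnWith,
    (lipschitzWith_slide h hu hv (abs_sub_comm κ κ' ▸ hε) hκ').lipschitzOnWith⟩

end Lipschitz

end Slide

section EdgeAction

/-- A reparametrization of the unit interval, extended monotonically to the real line. -/
structure IsReparam (e : ℝ → ℝ) : Prop where
  monotone : Monotone e
  continuous : Continuous e
  zero : e 0 = 0
  one : e 1 = 1

/-- The reparametrization `e` seen from the other end of the interval. -/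
def rev (e : ℝ → ℝ) (s : ℝ) : ℝ := 1 - e (1 - s)

/-- The reparametrization that takes `[0, κ]` to `[0, ρ]` by a rescaled copy of `e₁` and `[κ, 1]` to
`[ρ, 1]` by a rescaled copy of `e₂`. -/
def concat (κ ρ : ℝ) (e₁ e₂ : ℝ → ℝ) (s : ℝ) : ℝ :=
  ρ * e₁ (min (s / κ) 1) + (1 - ρ) * e₂ (max ((s - κ) / (1 - κ)) 0)

/-- `F` maps the segment `[p, q]` to itself by the reparametrization `e`. -/
def ActsOn (F : Plane → Plane) (p q : Plane) (e : ℝ → ℝ) : Prop :=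
  ∀ s ∈ Set.Icc (0 : ℝ) 1, F (AffineMap.lineMap p q s) = AffineMap.lineMap p q (e s)

variable {e e₁ e₂ : ℝ → ℝ} {κ ρ : ℝ}

theorem isReparam_id : IsReparam id := ⟨monotone_id, continuous_id, rfl, rfl⟩

theorem IsReparam.mapsTo (he : IsReparam e) : Set.MapsTo e (Set.Icc 0 1) (Set.Icc 0 1) :=
  fun _ hs => ⟨he.zero ▸ he.monotone hs.1, he.one ▸ he.monotone hs.2⟩

theorem IsReparam.surjOn (he : IsReparam e) : Set.SurjOn e (Set.Icc 0 1) (Set.Icc 0 1) := by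
  have := intermediate_value_Icc zero_le_one he.continuous.continuousOn
  rwa [he.zero, he.one] at this

theorem IsReparam.rev (he : IsReparam e) : IsReparam (rev e) where
  monotone s t hst := sub_le_sub_left (he.monotone (sub_le_sub_left hst 1)) 1
  continuous := continuous_const.sub (he.continuous.comp (continuous_const.sub continuous_id))
  zero := by simp [Penrose.rev, he.one]
  one := by simp [Penrose.rev, he.zero]

theorem rev_rev (e : ℝ → ℝ) : rev (rev e) = e := by
  ext s
  simp only [rev, sub_sub_cancel]

theorem ActsOn.rev {F : Plane → Plane} {p q : Plane} (h : ActsOn F p q e) :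
    ActsOn F q p (rev e) := by
  intro s hs
  rw [← AffineMap.lineMap_apply_one_sub, h _ (Set.Icc.one_sub_mem hs), Penrose.rev,
    AffineMap.lineMap_apply_one_sub]

theorem actsOn_id (p q : Plane) : ActsOn id p q id := fun _ _ => rfl

theorem eqOn_segment_of_actsOn {F₁ F₂ : Plane → Plane} {p q : Plane} (h₁ : ActsOn F₁ p q e)
    (h₂ : ActsOn F₂ p q e) : Set.EqOn F₁ F₂ (segment ℝ p q) := by
  rw [segment_eq_image_lineMap]
  rintro _ ⟨s, hs, rfl⟩
  rw [h₁ s hs, h₂ s hs]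

theorem eqOn_symm_segment_of_actsOn {F₁ G₁ F₂ G₂ : Plane → Plane} {S₁ S₁' S₂ S₂' : Set Plane}
    {L : ℝ≥0} {p q : Plane} (hB₁ : BiLipOn L S₁ S₁' F₁ G₁) (hB₂ : BiLipOn L S₂ S₂' F₂ G₂)
    (he : IsReparam e) (h₁ : ActsOn F₁ p q e) (h₂ : ActsOn F₂ p q e) (hS₁ : segment ℝ p q ⊆ S₁)
    (hS₂ : segment ℝ p q ⊆ S₂) : Set.EqOn G₁ G₂ (segment ℝ p q) := by
  rw [segment_eq_image_lineMap] at *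
  rintro _ ⟨s, hs, rfl⟩
  obtain ⟨r, hr, rfl⟩ := he.surjOn hs
  have hr' : AffineMap.lineMap p q r ∈ AffineMap.lineMap p q '' Set.Icc (0 : ℝ) 1 := ⟨r, hr, rfl⟩
  conv_lhs => rw [← h₁ r hr, hB₁.invOn.1 (hS₁ hr')]
  rw [← h₂ r hr, hB₂.invOn.1 (hS₂ hr')]

theorem mapsTo_symm_segment_of_actsOn {F G : Plane → Plane} {S S' : Set Plane} {L : ℝ≥0}
    {p q : Plane} (hB : BiLipOn L S S' F G) (he : IsReparam e) (h : ActsOn F p q e)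
    (hS : segment ℝ p q ⊆ S) : Set.MapsTo G (segment ℝ p q) (segment ℝ p q) := by
  rw [segment_eq_image_lineMap] at *
  rintro _ ⟨s, hs, rfl⟩
  obtain ⟨r, hr, rfl⟩ := he.surjOn hs
  rw [← h r hr, hB.invOn.1 (hS ⟨r, hr, rfl⟩)]
  exact ⟨r, hr, rfl⟩

section Concat

variable (hκ : κ ∈ Set.Ioo 0 1)
include hκ

theorem concat_mul (he₂ : IsReparam e₂) {s : ℝ} (hs : s ≤ 1) :
    concat κ ρ e₁ e₂ (κ * s) = ρ * e₁ s := by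
  have hle : (κ * s - κ) / (1 - κ) ≤ 0 :=
    div_nonpos_of_nonpos_of_nonneg (by nlinarith [hκ.1]) (sub_pos.2 hκ.2).le
  rw [concat, mul_div_cancel_left₀ s hκ.1.ne', min_eq_left hs, max_eq_right hle, he₂.zero, mul_zero,
    add_zero]

theorem concat_add_mul (he₁ : IsReparam e₁) {s : ℝ} (hs : 0 ≤ s) :
    concat κ ρ e₁ e₂ (κ + (1 - κ) * s) = ρ + (1 - ρ) * e₂ s := by
  have hκ₁ := sub_pos.2 hκ.2
  have hle : 1 ≤ (κ + (1 - κ) * s) / κ :=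
    (one_le_div hκ.1).2 (le_add_of_nonneg_right (mul_nonneg hκ₁.le hs))
  rw [concat, min_eq_right hle, add_sub_cancel_left, mul_div_cancel_left₀ s hκ₁.ne', max_eq_left hs,
    he₁.one, mul_one]

theorem isReparam_concat (hρ : ρ ∈ Set.Ioo 0 1) (he₁ : IsReparam e₁) (he₂ : IsReparam e₂) :
    IsReparam (concat κ ρ e₁ e₂) where
  monotone s t hst := by
    have hκ₀ := hκ.1
    have hκ₁ := sub_pos.2 hκ.2
    have hρ₁ := sub_pos.2 hρ.2
    exact add_le_add (mul_le_mul_of_nonneg_left (he₁.monotone (by gcongr)) hρ.1.le)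
      (mul_le_mul_of_nonneg_left (he₂.monotone (by gcongr)) hρ₁.le)
  continuous := by
    have := he₁.continuous
    have := he₂.continuous
    unfold concat
    fun_prop
  zero := by simpa [he₁.zero] using concat_mul (e₁ := e₁) (ρ := ρ) hκ he₂ zero_le_one
  one := by simpa [he₂.one] using concat_add_mul (e₂ := e₂) (ρ := ρ) hκ he₁ zero_le_one

theorem exists_eq_mul_or_eq_add_mul {s : ℝ} (hs : s ∈ Set.Icc (0 : ℝ) 1) :
    ∃ t ∈ Set.Icc (0 : ℝ) 1, s = κ * t ∨ s = κ + (1 - κ) * t := by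
  have hκ₁ := sub_pos.2 hκ.2
  rcases le_total s κ with hle | hle
  · exact ⟨s / κ, ⟨div_nonneg hs.1 hκ.1.le, div_le_one_of_le₀ hle hκ.1.le⟩,
      Or.inl (mul_div_cancel₀ s hκ.1.ne').symm⟩
  · refine ⟨(s - κ) / (1 - κ), ⟨div_nonneg (sub_nonneg.2 hle) hκ₁.le,
      div_le_one_of_le₀ (sub_le_sub_right hs.2 κ) hκ₁.le⟩, Or.inr ?_⟩
    rw [mul_div_cancel₀ _ hκ₁.ne', add_sub_cancel]

end Concat

end EdgeAction

section Step

variable {u v w : Plane} {κ ρ : ℝ} {F F₁ F₂ : Plane → Plane} {e e₁ e₂ : ℝ → ℝ}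

theorem segment_subset_triangle (u v w : Plane) : segment ℝ u v ⊆ triangle u v w :=
  segment_subset_convexHull (by simp) (by simp)

theorem lineMap_mem_triangle (u v w : Plane) {s : ℝ} (hs : s ∈ Set.Icc (0 : ℝ) 1) :
    AffineMap.lineMap u v s ∈ triangle u v w :=
  segment_subset_triangle u v w (segment_eq_image_lineMap ℝ u v ▸ ⟨s, hs, rfl⟩)

variable (h : doubleArea u v w ≠ 0)
include h

theorem exists_biLipOn_slide {C ε L : ℝ≥0} {G₁ G₂ : Plane → Plane}
    (hκ : κ ∈ Set.Icc (1 / 3) (2 / 3)) (hρ : ρ ∈ Set.Icc (1 / 3) (2 / 3))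
    (hu : dist u v * dist u w ≤ C * |doubleArea u v w|)
    (hv : dist u v * dist v w ≤ C * |doubleArea u v w|) (hε : |ρ - κ| ≤ ε)
    (h₁ : BiLipOn L (triangle u (AffineMap.lineMap u v κ) w)
      (triangle u (AffineMap.lineMap u v κ) w) F₁ G₁)
    (h₂ : BiLipOn L (triangle (AffineMap.lineMap u v κ) v w)
      (triangle (AffineMap.lineMap u v κ) v w) F₂ G₂)
    (he : IsReparam e) (a₁ : ActsOn F₁ w (AffineMap.lineMap u v κ) e)
    (a₂ : ActsOn F₂ w (AffineMap.lineMap u v κ) e) :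
    ∃ F G, BiLipOn ((1 + 3 * C * ε) * L) (triangle u v w) (triangle u v w) F G ∧
      Set.EqOn F (slide κ ρ u v w ∘ F₁) (triangle u (AffineMap.lineMap u v κ) w) ∧
      Set.EqOn F (slide κ ρ u v w ∘ F₂) (triangle (AffineMap.lineMap u v κ) v w) := by
  have hκ' : κ ∈ Set.Ioo 0 1 := Set.Icc_subset_Ioo (by norm_num) (by norm_num) hκ
  have common := parts_inter_subset h hκ'
  have convex_union : Convex ℝ (triangle u (AffineMap.lineMap u v κ) w ∪
      triangle (AffineMap.lineMap u v κ) v w) :=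
    triangle_eq_union h hκ' ▸ convex_triangle u v w
  have segment_subset (x : Plane) :
      segment ℝ w (AffineMap.lineMap u v κ) ⊆ triangle x (AffineMap.lineMap u v κ) w := by
    rw [segment_symm, ← triangle_rotate]
    exact segment_subset_triangle _ _ _
  have eqOn_symm := eqOn_symm_segment_of_actsOn h₁ h₂ he a₁ a₂ (segment_subset u)
    (triangle_swap (AffineMap.lineMap u v κ) v w ▸ segment_subset v)
  obtain ⟨F, G, hFG, hF₁, hF₂⟩ := h₁.glue h₂ ((eqOn_segment_of_actsOn a₁ a₂).mono common)
    (eqOn_symm.mono common) (isClosed_triangle _ _ _) (isClosed_triangle _ _ _) convex_union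
    (isClosed_triangle _ _ _) (isClosed_triangle _ _ _) convex_union
  rw [triangle_eq_union h hκ'] at hFG
  exact ⟨_, _, (biLipOn_slide h hu hv hε hκ hρ).comp hFG, hF₁.comp_left, hF₂.comp_left⟩

variable (hκ : κ ∈ Set.Ioo 0 1)
include hκ

theorem actsOn_concat
    (hF₁ : Set.EqOn F (slide κ ρ u v w ∘ F₁) (triangle u (AffineMap.lineMap u v κ) w))
    (hF₂ : Set.EqOn F (slide κ ρ u v w ∘ F₂) (triangle (AffineMap.lineMap u v κ) v w))
    (he₁ : IsReparam e₁) (he₂ : IsReparam e₂) (a₁ : ActsOn F₁ u (AffineMap.lineMap u v κ) e₁)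
    (a₂ : ActsOn F₂ (AffineMap.lineMap u v κ) v e₂) : ActsOn F u v (concat κ ρ e₁ e₂) := by
  intro s hs
  obtain ⟨t, ht, rfl | rfl⟩ := exists_eq_mul_or_eq_add_mul hκ hs
  · have lineMap_mul (r : ℝ) : (AffineMap.lineMap u v (κ * r) : Plane) =
        AffineMap.lineMap u (AffineMap.lineMap u v κ) r := by
      rw [AffineMap.lineMap_lineMap_right, mul_comm]
    rw [lineMap_mul, hF₁ (lineMap_mem_triangle _ _ _ ht), Function.comp_apply, a₁ t ht,
      ← lineMap_mul, slide_lineMap_left h hκ (he₁.mapsTo ht).2, concat_mul hκ he₂ ht.2]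
  · have lineMap_add_mul (r : ℝ) : (AffineMap.lineMap u v (κ + (1 - κ) * r) : Plane) =
        AffineMap.lineMap (AffineMap.lineMap u v κ) v r := by
      rw [AffineMap.lineMap_lineMap_left]
      congr 1
      ring
    rw [lineMap_add_mul, hF₂ (lineMap_mem_triangle _ _ _ ht), Function.comp_apply, a₂ t ht,
      ← lineMap_add_mul, slide_lineMap_right h hκ (he₂.mapsTo ht).1, concat_add_mul hκ he₁ ht.1]

theorem actsOn_left_apex
    (hF : Set.EqOn F (slide κ ρ u v w ∘ F₁) (triangle u (AffineMap.lineMap u v κ) w))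
    (he : IsReparam e) (a : ActsOn F₁ u w e) : ActsOn F u w e := by
  intro s hs
  have hmem : AffineMap.lineMap u w s ∈ triangle u (AffineMap.lineMap u v κ) w := by
    rw [← triangle_rotate, ← triangle_rotate, triangle_swap]
    exact lineMap_mem_triangle _ _ _ hs
  rw [hF hmem, Function.comp_apply, a s hs, slide_lineMap_apex h hκ (he.mapsTo hs).2]

theorem actsOn_right_apex
    (hF : Set.EqOn F (slide κ ρ u v w ∘ F₂) (triangle (AffineMap.lineMap u v κ) v w))
    (he : IsReparam e) (a : ActsOn F₂ v w e) : ActsOn F v w e := by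
  intro s hs
  have hmem : AffineMap.lineMap v w s ∈ triangle (AffineMap.lineMap u v κ) v w := by
    rw [← triangle_rotate]
    exact lineMap_mem_triangle _ _ _ hs
  rw [hF hmem, Function.comp_apply, a s hs, slide_lineMap_apex' h hκ (he.mapsTo hs).2]

end Step

section GoldenRatio

theorem inv_goldenRatio_eq_sub_one : (φ⁻¹ : ℝ) = φ - 1 := by
  rw [Real.inv_goldenRatio, ← Real.one_sub_goldenConj, neg_sub]

theorem inv_goldenRatio_sq : (φ⁻¹ : ℝ) ^ 2 = 1 - φ⁻¹ := by
  rw [inv_goldenRatio_eq_sub_one]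
  linarith [Real.goldenRatio_sq]

theorem goldenRatio_mem_Ioo : φ ∈ Set.Ioo (8 / 5) (5 / 3) := by
  constructor <;> nlinarith [Real.goldenRatio_sq, Real.goldenRatio_pos]

theorem inv_goldenRatio_mem_Icc : φ⁻¹ ∈ Set.Icc (1 / 3) (2 / 3) := by
  obtain ⟨lower, upper⟩ := goldenRatio_mem_Ioo
  rw [inv_goldenRatio_eq_sub_one]
  constructor <;> linarith

theorem inv_goldenRatio_mem_Ioo : φ⁻¹ ∈ Set.Ioo 0 1 :=
  Set.Icc_subset_Ioo (by norm_num) (by norm_num) inv_goldenRatio_mem_Icc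

theorem cast_fib_succ_pos (n : ℕ) : (0 : ℝ) < Nat.fib (n + 1) :=
  Nat.cast_pos.2 (Nat.fib_pos.2 n.succ_pos)

theorem cast_fib_add_two (n : ℕ) : (Nat.fib (n + 2) : ℝ) = Nat.fib n + Nat.fib (n + 1) :=
  mod_cast Nat.fib_add_two

theorem cast_fib_succ_le_goldenRatio_pow (n : ℕ) : (Nat.fib (n + 1) : ℝ) ≤ φ ^ n := by
  obtain _ | n := n
  · simp
  · rw [← Real.goldenRatio_mul_fib_succ_add_fib, cast_fib_add_two, add_comm]
    gcongr
    exact le_mul_of_one_le_left (Nat.cast_nonneg _) Real.one_lt_goldenRatio.le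

theorem goldenRatio_pow_le_two_mul_cast_fib_succ (n : ℕ) : φ ^ n ≤ 2 * (Nat.fib (n + 1) : ℝ) := by
  obtain _ | n := n
  · simp
  · rw [← Real.goldenRatio_mul_fib_succ_add_fib, cast_fib_add_two, mul_add, add_comm]
    gcongr
    · exact le_mul_of_one_le_left (Nat.cast_nonneg _) one_le_two
    · exact Real.goldenRatio_lt_two.le

/-- The convergent `fib (n + 2) / fib (n + 3)` of `φ⁻¹`: the proportion of the half tiles of a
dissection that lie on one side of its first cut. -/
def fibRatio (n : ℕ) : ℝ := Nat.fib (n + 2) / Nat.fib (n + 3)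

theorem fibRatio_mul_fib (n : ℕ) : fibRatio n * Nat.fib (n + 3) = Nat.fib (n + 2) :=
  div_mul_cancel₀ _ (cast_fib_succ_pos _).ne'

theorem one_sub_fibRatio_mul_fib (n : ℕ) :
    (1 - fibRatio n) * Nat.fib (n + 3) = Nat.fib (n + 1) := by
  rw [sub_mul, fibRatio_mul_fib, cast_fib_add_two (n + 1)]
  ring

theorem fibRatio_mem_Icc (n : ℕ) : fibRatio n ∈ Set.Icc (1 / 3) (2 / 3) := by
  have hpos := cast_fib_succ_pos n
  have rec₀ := cast_fib_add_two n
  have rec₁ := cast_fib_add_two (n + 1)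
  have mono : (Nat.fib n : ℝ) ≤ Nat.fib (n + 1) := Nat.cast_le.2 Nat.fib_le_fib_succ
  have hpos₃ := cast_fib_succ_pos (n + 2)
  rw [fibRatio, Set.mem_Icc, le_div_iff₀ hpos₃, div_le_iff₀ hpos₃]
  constructor <;> linarith

theorem fibRatio_mem_Ioo (n : ℕ) : fibRatio n ∈ Set.Ioo 0 1 :=
  Set.Icc_subset_Ioo (by norm_num) (by norm_num) (fibRatio_mem_Icc n)

theorem abs_fibRatio_sub_le (n : ℕ) : |fibRatio n - φ⁻¹| ≤ (φ⁻¹ : ℝ) ^ (n + 1) := by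
  have hφ := Real.goldenRatio_pos
  have hfib := cast_fib_succ_pos (n + 2)
  have error : fibRatio n - φ⁻¹ = -(Real.goldenConj ^ (n + 2) / (φ * Nat.fib (n + 3))) := by
    rw [← Real.fib_succ_sub_goldenRatio_mul_fib, fibRatio]
    field_simp
    ring
  have one_le : (1 : ℝ) ≤ φ * Nat.fib (n + 3) :=
    one_le_mul_of_one_le_of_one_le Real.one_lt_goldenRatio.le
      (Nat.one_le_cast.2 (Nat.fib_pos.2 (by omega)))
  rw [error, abs_neg, abs_div, abs_of_pos (mul_pos hφ hfib), abs_pow,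
    abs_of_neg Real.goldenConj_neg, ← Real.inv_goldenRatio]
  exact (div_le_self (by positivity) one_le).trans (pow_le_pow_of_le_one
    inv_goldenRatio_mem_Ioo.1.le inv_goldenRatio_mem_Ioo.2.le (by omega))

/-- The bi-Lipschitz constant accumulated over `n` levels of dissection. -/
def lipConst (n : ℕ) : ℝ≥0 := ∏ j ∈ Finset.range n, (1 + 6 * (φ⁻¹ : ℝ).toNNReal ^ j)

theorem lipConst_le_succ (n : ℕ) : lipConst n ≤ lipConst (n + 1) := by
  rw [lipConst, lipConst, Finset.prod_range_succ]
  exact le_mul_of_one_le_right' (self_le_add_right 1 _)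

theorem lipConst_mono : Monotone lipConst := monotone_nat_of_le_succ lipConst_le_succ

theorem exists_lipConst_le : ∃ K > 0, ∀ n, lipConst n ≤ K := by
  have hsum : Summable fun j => 6 * ((φ⁻¹ : ℝ).toNNReal : ℝ) ^ j :=
    (summable_geometric_of_lt_one NNReal.zero_le_coe
      (by simpa using inv_goldenRatio_mem_Ioo.2)).mul_left 6
  refine ⟨(Real.exp (∑' j, 6 * ((φ⁻¹ : ℝ).toNNReal : ℝ) ^ j)).toNNReal,
    Real.toNNReal_pos.2 (Real.exp_pos _), fun n => ?_⟩
  rw [Real.le_toNNReal_iff_coe_le (Real.exp_pos _).le, lipConst, NNReal.coe_prod]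
  push_cast
  exact (Real.prod_one_add_le_exp_sum _ fun _ => by positivity).trans
    (Real.exp_le_exp.2 (hsum.sum_le_tsum _ fun _ _ => by positivity))

end GoldenRatio

section TriangleVolume

/-- The linear map of the plane whose matrix has the columns `p` and `q`. -/
def ofColumns (p q : Plane) : Plane →ₗ[ℝ] Plane :=
  (EuclideanSpace.projₗ 0).smulRight p + (EuclideanSpace.projₗ 1).smulRight q

theorem ofColumns_apply (p q x : Plane) : ofColumns p q x = x 0 • p + x 1 • q := rfl

theorem det_ofColumns (p q : Plane) : LinearMap.det (ofColumns p q) = cross p q := by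
  rw [← LinearMap.det_toMatrix (EuclideanSpace.basisFun (Fin 2) ℝ).toBasis, Matrix.det_fin_two]
  simp only [LinearMap.toMatrix_apply, ofColumns_apply, cross_apply]
  simp
  ring

theorem triangle_eq_image (u v w : Plane) :
    triangle u v w = (u + ·) '' (ofColumns (v - u) (w - u) '' triangle 0 !₂[1, 0] !₂[0, 1]) := by
  rw [triangle, triangle, LinearMap.image_convexHull]
  refine Eq.trans ?_ (convexHull_vadd (𝕜 := ℝ) u _)
  simp [← Set.image_vadd, Set.image_insert_eq, ofColumns_apply]

theorem exists_volume_real_triangle_eq :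
    ∃ c > 0, ∀ u v w, volume.real (triangle u v w) = c * |doubleArea u v w| := by
  have hne : doubleArea 0 !₂[1, 0] !₂[0, 1] ≠ 0 := by simp [doubleArea_eq]
  refine ⟨volume.real (triangle 0 !₂[1, 0] !₂[0, 1]), ?_, fun u v w => ?_⟩
  · refine ENNReal.toReal_pos ?_ (isCompact_triangle _ _ _).measure_lt_top.ne
    exact (Measure.measure_pos_of_nonempty_interior _ (interior_triangle_nonempty hne)).ne'
  · rw [triangle_eq_image, measureReal_def, Set.image_add_left, measure_preimage_add,
      Measure.addHaar_image_linearMap, det_ofColumns, ENNReal.toReal_mul,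
      ENNReal.toReal_ofReal (abs_nonneg _), mul_comm]
    rfl

theorem volume_real_triangle_pos {u v w : Plane} (h : doubleArea u v w ≠ 0) :
    0 < volume.real (triangle u v w) := by
  obtain ⟨c, hc, hvol⟩ := exists_volume_real_triangle_eq
  exact hvol u v w ▸ mul_pos hc (abs_pos.2 h)

theorem volume_real_triangle_congr {u v w u' v' w' : Plane} (huv : dist u v = dist u' v')
    (huw : dist u w = dist u' w') (hvw : dist v w = dist v' w') :
    volume.real (triangle u v w) = volume.real (triangle u' v' w') := by
  obtain ⟨c, -, hvol⟩ := exists_volume_real_triangle_eq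
  have sq_eq : doubleArea u v w ^ 2 = doubleArea u' v' w' ^ 2 := by
    have heron := doubleArea_sq u v w
    rw [huv, huw, hvw, ← doubleArea_sq] at heron
    linarith
  rw [hvol, hvol, (sq_eq_sq_iff_abs_eq_abs _ _).1 sq_eq]

theorem volume_real_triangle_lineMap_left (u v w : Plane) {κ : ℝ} (hκ : 0 ≤ κ) :
    volume.real (triangle u (AffineMap.lineMap u v κ) w) = κ * volume.real (triangle u v w) := by
  obtain ⟨c, -, hvol⟩ := exists_volume_real_triangle_eq
  rw [hvol, hvol, doubleArea_lineMap_left, abs_mul, abs_of_nonneg hκ, mul_left_comm]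

theorem volume_real_triangle_lineMap_right (u v w : Plane) {κ : ℝ} (hκ : κ ≤ 1) :
    volume.real (triangle (AffineMap.lineMap u v κ) v w) =
      (1 - κ) * volume.real (triangle u v w) := by
  obtain ⟨c, -, hvol⟩ := exists_volume_real_triangle_eq
  rw [hvol, hvol, doubleArea_lineMap_right, abs_mul, abs_of_nonneg (sub_nonneg.2 hκ),
    mul_left_comm]

end TriangleVolume

section GoldenTriangle

/-- The two shapes of golden triangles: with angles 36°, 72°, 72° and with angles 108°, 36°, 36°. -/
inductive Shape
  | acute
  | obtuse

/-- `u`, `v`, `w` are the vertices of a golden triangle of the given shape, labelled so that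
`[u, v]` is the side that gets divided: the apex is `u` if the triangle is acute and `w` if it is
obtuse. -/
def Shape.IsGolden : Shape → Plane → Plane → Plane → Prop
  | acute, u, v, w => 0 < dist v w ∧ dist u v = φ * dist v w ∧ dist u w = φ * dist v w
  | obtuse, u, v, w => 0 < dist u w ∧ dist v w = dist u w ∧ dist u v = φ * dist u w

theorem goldenRatio_pow_four : φ ^ 4 = 3 * φ + 2 := by
  linear_combination (φ ^ 2 + φ + 2) * Real.goldenRatio_sq

theorem dist_sq_lineMap (u v w : Plane) (κ : ℝ) :
    dist w (AffineMap.lineMap u v κ) ^ 2 =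
      (1 - κ) * dist u w ^ 2 + κ * dist v w ^ 2 - κ * (1 - κ) * dist u v ^ 2 := by
  simp only [dist_eq_norm, norm_sq_eq_coords, PiLp.sub_apply, lineMap_coord]
  ring

theorem dist_left_cut (u v : Plane) : dist u (HalfTile.cut u v) = φ⁻¹ * dist u v := by
  rw [HalfTile.cut, dist_left_lineMap, Real.norm_of_nonneg inv_goldenRatio_mem_Ioo.1.le]

theorem dist_cut_right (u v : Plane) : dist (HalfTile.cut u v) v = φ⁻¹ ^ 2 * dist u v := by
  rw [HalfTile.cut, dist_lineMap_right, ← inv_goldenRatio_sq, Real.norm_of_nonneg (sq_nonneg _)]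

namespace Shape

variable {u v w : Plane}

theorem IsGolden.dist_mul_dist_le_acute (h : acute.IsGolden u v w) :
    dist u v * dist u w ≤ 2 * |doubleArea u v w| := by
  obtain ⟨hd, huv, huw⟩ := h
  have heron : (2 * |doubleArea u v w|) ^ 2 =
      (dist u v * dist u w) ^ 2 + (φ + 1) * dist v w ^ 4 := by
    rw [mul_pow, sq_abs]
    have := doubleArea_sq u v w
    rw [huv, huw] at *
    linear_combination this + 4 * dist v w ^ 4 * Real.goldenRatio_sq
      - dist v w ^ 4 * goldenRatio_pow_four
  have := Real.goldenRatio_pos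
  exact (sq_le_sq₀ (by positivity) (by positivity)).1
    (heron ▸ le_add_of_nonneg_right (by positivity))

theorem IsGolden.dist_mul_dist_le_obtuse (h : obtuse.IsGolden u v w) :
    dist u v * dist u w ≤ 2 * |doubleArea u v w| := by
  obtain ⟨hd, hvw, huv⟩ := h
  have heron : (2 * |doubleArea u v w|) ^ 2 = (dist u v * dist u w) ^ 2 + dist u w ^ 4 := by
    rw [mul_pow, sq_abs]
    have := doubleArea_sq u v w
    rw [huv, hvw] at *
    linear_combination this + 3 * dist u w ^ 4 * Real.goldenRatio_sq
      - dist u w ^ 4 * goldenRatio_pow_four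
  exact (sq_le_sq₀ (by positivity) (by positivity)).1
    (heron ▸ le_add_of_nonneg_right (by positivity))

theorem IsGolden.dist_cut_acute (h : acute.IsGolden u v w) :
    dist w (HalfTile.cut u v) = dist v w := by
  obtain ⟨-, huv, huw⟩ := h
  rw [← sq_eq_sq₀ dist_nonneg dist_nonneg, HalfTile.cut, dist_sq_lineMap, huv, huw,
    inv_goldenRatio_eq_sub_one]
  linear_combination (φ ^ 2 - 3 * φ + 2) * dist v w ^ 2 * Real.goldenRatio_sq

theorem IsGolden.dist_cut_obtuse (h : obtuse.IsGolden u v w) :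
    dist w (HalfTile.cut u v) = φ⁻¹ * dist u w := by
  obtain ⟨-, hvw, huv⟩ := h
  have := Real.goldenRatio_pos
  rw [← sq_eq_sq₀ dist_nonneg (by positivity), HalfTile.cut, dist_sq_lineMap, hvw, huv,
    inv_goldenRatio_eq_sub_one]
  linear_combination (φ ^ 2 - 2 * φ) * dist u w ^ 2 * Real.goldenRatio_sq

theorem IsGolden.left_acute (h : acute.IsGolden u v w) :
    obtuse.IsGolden w u (HalfTile.cut u v) := by
  have apex := h.dist_cut_acute
  obtain ⟨hd, huv, huw⟩ := h
  refine ⟨by rwa [apex], ?_, by rw [apex, dist_comm, huw]⟩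
  rw [apex, dist_left_cut, huv, inv_mul_cancel_left₀ Real.goldenRatio_ne_zero]

theorem IsGolden.right_acute (h : acute.IsGolden u v w) :
    acute.IsGolden w (HalfTile.cut u v) v := by
  have apex := h.dist_cut_acute
  obtain ⟨hd, huv, -⟩ := h
  have base : dist (HalfTile.cut u v) v = φ⁻¹ * dist v w := by
    rw [dist_cut_right, huv, sq, mul_assoc, inv_mul_cancel_left₀ Real.goldenRatio_ne_zero]
  refine ⟨by rw [base]; exact mul_pos inv_goldenRatio_mem_Ioo.1 hd, ?_, ?_⟩ <;>
    rw [base, mul_inv_cancel_left₀ Real.goldenRatio_ne_zero]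
  · exact apex
  · exact dist_comm w v

theorem IsGolden.left_obtuse (h : obtuse.IsGolden u v w) :
    acute.IsGolden u w (HalfTile.cut u v) := by
  have base := h.dist_cut_obtuse
  obtain ⟨hd, -, huv⟩ := h
  refine ⟨by rw [base]; exact mul_pos inv_goldenRatio_mem_Ioo.1 hd, ?_, ?_⟩ <;>
    rw [base, mul_inv_cancel_left₀ Real.goldenRatio_ne_zero]
  rw [dist_left_cut, huv, inv_mul_cancel_left₀ Real.goldenRatio_ne_zero]

theorem IsGolden.right_obtuse (h : obtuse.IsGolden u v w) :
    obtuse.IsGolden v w (HalfTile.cut u v) := by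
  have apex := h.dist_cut_obtuse
  obtain ⟨hd, hvw, huv⟩ := h
  have side : dist v (HalfTile.cut u v) = φ⁻¹ * dist u w := by
    rw [dist_comm, dist_cut_right, huv, sq, mul_assoc,
      inv_mul_cancel_left₀ Real.goldenRatio_ne_zero]
  refine ⟨by rw [side]; exact mul_pos inv_goldenRatio_mem_Ioo.1 hd, by rw [apex, side], ?_⟩
  rw [side, mul_inv_cancel_left₀ Real.goldenRatio_ne_zero, hvw]

end Shape

/-- A golden triangle, with its vertices in the order of `Shape.IsGolden`. -/
structure GoldenTriangle where
  shape : Shape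
  u : Plane
  v : Plane
  w : Plane
  isGolden : shape.IsGolden u v w

namespace GoldenTriangle

variable (T : GoldenTriangle)

/-- The closed triangle in the plane. -/
def region : Set Plane := triangle T.u T.v T.w

/-- The point at which the Penrose substitution divides the side `[u, v]`. -/
def cut : Plane := HalfTile.cut T.u T.v

/-- The part of a golden triangle that the segment from `w` to the dividing point leaves at `u`. -/
def left : GoldenTriangle → GoldenTriangle
  | ⟨.acute, u, v, w, h⟩ => ⟨.obtuse, w, u, HalfTile.cut u v, h.left_acute⟩
  | ⟨.obtuse, u, v, w, h⟩ => ⟨.acute, u, w, HalfTile.cut u v, h.left_obtuse⟩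

/-- The part of a golden triangle that the segment from `w` to the dividing point leaves at `v`. -/
def right : GoldenTriangle → GoldenTriangle
  | ⟨.acute, u, v, w, h⟩ => ⟨.acute, w, HalfTile.cut u v, v, h.right_acute⟩
  | ⟨.obtuse, u, v, w, h⟩ => ⟨.obtuse, v, w, HalfTile.cut u v, h.right_obtuse⟩

theorem region_left : T.left.region = triangle T.u T.cut T.w := by
  obtain ⟨_ | _, u, v, w, h⟩ := T
  · exact (triangle_rotate w u _).symm
  · rw [← triangle_rotate, ← triangle_rotate, ← triangle_swap]
    rfl

theorem region_right : T.right.region = triangle T.cut T.v T.w := by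
  obtain ⟨_ | _, u, v, w, h⟩ := T
  · rw [← triangle_rotate, ← triangle_rotate]
    rfl
  · exact triangle_rotate _ v w

theorem dist_mul_dist_le : dist T.u T.v * dist T.u T.w ≤ 2 * |doubleArea T.u T.v T.w| := by
  obtain ⟨_ | _, u, v, w, h⟩ := T
  exacts [h.dist_mul_dist_le_acute, h.dist_mul_dist_le_obtuse]

theorem dist_right_le : dist T.v T.w ≤ dist T.u T.w := by
  obtain ⟨_ | _, u, v, w, h⟩ := T
  · exact h.2.2 ▸ le_mul_of_one_le_left dist_nonneg Real.one_lt_goldenRatio.le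
  · exact h.2.1.le

theorem dist_mul_dist_le' : dist T.u T.v * dist T.v T.w ≤ 2 * |doubleArea T.u T.v T.w| :=
  (mul_le_mul_of_nonneg_left T.dist_right_le dist_nonneg).trans T.dist_mul_dist_le

theorem dist_pos : 0 < dist T.u T.v ∧ 0 < dist T.u T.w := by
  have := Real.goldenRatio_pos
  obtain ⟨_ | _, u, v, w, h⟩ := T
  · exact ⟨h.2.1 ▸ mul_pos this h.1, h.2.2 ▸ mul_pos this h.1⟩
  · exact ⟨h.2.2 ▸ mul_pos this h.1, h.1⟩

theorem doubleArea_ne_zero : doubleArea T.u T.v T.w ≠ 0 := by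
  have := T.dist_mul_dist_le.trans_lt' (mul_pos T.dist_pos.1 T.dist_pos.2)
  exact abs_pos.1 (pos_of_mul_pos_right this zero_le_two)

/-- The area of a golden triangle. -/
def area : ℝ := volume.real T.region

theorem area_pos : 0 < T.area := volume_real_triangle_pos T.doubleArea_ne_zero

theorem area_left : T.left.area = φ⁻¹ * T.area := by
  rw [area, region_left]
  exact volume_real_triangle_lineMap_left _ _ _ inv_goldenRatio_mem_Ioo.1.le

theorem area_right : T.right.area = (1 - φ⁻¹) * T.area := by
  rw [area, region_right]
  exact volume_real_triangle_lineMap_right _ _ _ inv_goldenRatio_mem_Ioo.2.le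

theorem region_eq_union : T.region = T.left.region ∪ T.right.region := by
  rw [region_left, region_right]
  exact (triangle_eq_union T.doubleArea_ne_zero inv_goldenRatio_mem_Ioo).symm

theorem region_left_subset : T.left.region ⊆ T.region :=
  T.region_eq_union ▸ Set.subset_union_left

theorem region_right_subset : T.right.region ⊆ T.region :=
  T.region_eq_union ▸ Set.subset_union_right

end GoldenTriangle

end GoldenTriangle

section Dissection

namespace GoldenTriangle

variable (T : GoldenTriangle)

/-- The half thin rhomb or half dart that occupies a golden triangle. -/
def tile₀ : GoldenTriangle → HalfTile
  | ⟨.acute, u, v, w, _⟩ => ⟨.halfThin, u, v, w⟩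
  | ⟨.obtuse, u, v, w, _⟩ => ⟨.halfDart, v, w, u⟩

/-- The half kite or half thick rhomb that occupies a golden triangle. -/
def tile₁ : GoldenTriangle → HalfTile
  | ⟨.acute, u, v, w, _⟩ => ⟨.halfKite, w, u, v⟩
  | ⟨.obtuse, u, v, w, _⟩ => ⟨.halfThick, w, u, v⟩

theorem region_tile₀ : T.tile₀.region = T.region := by
  obtain ⟨_ | _, u, v, w, _⟩ := T
  · rfl
  · exact triangle_rotate u v w

theorem region_tile₁ : T.tile₁.region = T.region := by
  obtain ⟨_ | _, u, v, w, _⟩ := T <;> exact (triangle_rotate w u v).symm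

theorem isWellShaped_tile₀ : T.tile₀.IsWellShaped := by
  obtain ⟨_ | _, u, v, w, h⟩ := T
  · exact h
  · simpa only [tile₀, HalfTile.IsWellShaped, dist_comm w v, dist_comm w u, dist_comm v u, h.2.1]
      using ⟨h.1, trivial, h.2.2⟩

theorem isWellShaped_tile₁ : T.tile₁.IsWellShaped := by
  obtain ⟨_ | _, u, v, w, h⟩ := T <;>
    simp only [tile₁, HalfTile.IsWellShaped, dist_comm w v, dist_comm w u]
  exacts [⟨h.1, h.2.2, h.2.1⟩, h]

theorem mem_children_tile₀ {t : HalfTile} :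
    t ∈ T.tile₀.children ↔ t = T.left.tile₁ ∨ t = T.right.tile₀ := by
  obtain ⟨_ | _, u, v, w, _⟩ := T <;>
    simp only [tile₀, tile₁, left, right, HalfTile.children, List.mem_cons, List.not_mem_nil,
      or_false]
  all_goals exact or_comm

theorem mem_children_tile₁ {t : HalfTile} :
    t ∈ T.tile₁.children ↔
      t = T.left.right.tile₀ ∨ t = T.left.left.tile₁ ∨ t = T.right.tile₁ := by
  obtain ⟨_ | _, u, v, w, _⟩ := T <;>
    simp only [tile₀, tile₁, left, right, HalfTile.children, List.mem_cons, List.not_mem_nil,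
      or_false]
  tauto

/-- `IsLeaf n T t` says that `t` is one of the `Nat.fib (n + 1)` half tiles of the dissection of
level `n` of `T`, in which the left and the right part carry dissections of levels `n - 1` and
`n - 2`. One Penrose substitution raises the level by two. -/
inductive IsLeaf : ℕ → GoldenTriangle → HalfTile → Prop
  | tile₀ (T : GoldenTriangle) : IsLeaf 0 T T.tile₀
  | tile₁ (T : GoldenTriangle) : IsLeaf 1 T T.tile₁
  | left {n : ℕ} {T : GoldenTriangle} {t : HalfTile} : IsLeaf (n + 1) T.left t → IsLeaf (n + 2) T t
  | right {n : ℕ} {T : GoldenTriangle} {t : HalfTile} : IsLeaf n T.right t → IsLeaf (n + 2) T t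

variable {T} {n : ℕ} {s t : HalfTile}

theorem IsLeaf.of_mem_children (hs : IsLeaf n T s) (ht : t ∈ s.children) : IsLeaf (n + 2) T t := by
  induction hs with
  | tile₀ T =>
    rcases T.mem_children_tile₀.1 ht with rfl | rfl
    exacts [.left (.tile₁ _), .right (.tile₀ _)]
  | tile₁ T =>
    rcases T.mem_children_tile₁.1 ht with rfl | rfl | rfl
    exacts [.left (.right (.tile₀ _)), .left (.left (.tile₁ _)), .right (.tile₁ _)]
  | left _ ih => exact (ih ht).left
  | right _ ih => exact (ih ht).right

theorem IsLeaf.of_mem_descendants (hs : IsLeaf n T s) {m : ℕ} (ht : t ∈ s.descendants m) :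
    IsLeaf (n + 2 * m) T t := by
  induction m generalizing t with
  | zero => exact (show t = s from ht) ▸ hs
  | succ m ih =>
    obtain ⟨r, hr, ht⟩ := ht
    exact (ih hr).of_mem_children ht

theorem exists_isLeaf_of_isWellShaped (hs : s.IsWellShaped) : ∃ n T, IsLeaf n T s := by
  obtain ⟨_ | _ | _ | _, a, b, c⟩ := s <;> obtain ⟨h₀, h₁, h₂⟩ := hs
  · refine ⟨1, ⟨.acute, b, c, a, ?_, ?_, ?_⟩, .tile₁ _⟩ <;> rw [dist_comm c a] <;> assumption
  · refine ⟨0, ⟨.obtuse, c, a, b, ?_⟩, .tile₀ _⟩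
    simpa only [Shape.IsGolden, dist_comm c b, dist_comm c a, dist_comm a b, h₁, true_and]
      using ⟨h₀, h₂⟩
  · exact ⟨0, ⟨.acute, a, b, c, h₀, h₁, h₂⟩, .tile₀ _⟩
  · refine ⟨1, ⟨.obtuse, b, c, a, ?_⟩, .tile₁ _⟩
    simpa only [Shape.IsGolden, dist_comm b a, dist_comm c a] using ⟨h₀, h₁, h₂⟩

theorem IsLeaf.isWellShaped (ht : IsLeaf n T t) : t.IsWellShaped := by
  induction ht with
  | tile₀ T => exact T.isWellShaped_tile₀
  | tile₁ T => exact T.isWellShaped_tile₁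
  | left _ ih => exact ih
  | right _ ih => exact ih

theorem IsLeaf.region_subset (ht : IsLeaf n T t) : t.region ⊆ T.region := by
  induction ht with
  | tile₀ T => exact T.region_tile₀.subset
  | tile₁ T => exact T.region_tile₁.subset
  | left _ ih => exact ih.trans (region_left_subset _)
  | right _ ih => exact ih.trans (region_right_subset _)

theorem IsLeaf.exists_volume_real_mul_pow_eq (ht : IsLeaf n T t) :
    ∃ k ≤ 1, volume.real t.region * φ ^ n = T.area * φ ^ k := by
  induction ht with
  | tile₀ T => exact ⟨0, zero_le_one, by rw [region_tile₀]; rfl⟩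
  | tile₁ T => exact ⟨1, le_rfl, by rw [region_tile₁]; rfl⟩
  | left _ ih =>
    obtain ⟨k, hk, ih⟩ := ih
    refine ⟨k, hk, ?_⟩
    rw [pow_succ, ← mul_assoc, ih, area_left]
    field_simp
  | right _ ih =>
    obtain ⟨k, hk, ih⟩ := ih
    refine ⟨k, hk, ?_⟩
    rw [pow_add, ← mul_assoc, ih, area_right, ← inv_goldenRatio_sq]
    field_simp

end GoldenTriangle

end Dissection

section Edges

/-- A directed side of a triangle of a dissection, typed by the golden triangles that have it as
their side `[u, v]`: these have the given shape, and `level` is their level raised by three. Sides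
with `level < 5` are not subdivided. -/
structure Edge where
  shape : Shape
  level : ℕ
  p : Plane
  q : Plane

/-- The part between `p` and the dividing point of an edge with `5 ≤ level`. -/
def Edge.left : Edge → Edge
  | ⟨.acute, n, p, q⟩ => ⟨.obtuse, n - 3, p, HalfTile.cut p q⟩
  | ⟨.obtuse, n, p, q⟩ => ⟨.obtuse, n - 2, HalfTile.cut p q, p⟩

/-- The part between `q` and the dividing point of an edge with `5 ≤ level`. -/
def Edge.right : Edge → Edge
  | ⟨.acute, n, p, q⟩ => ⟨.obtuse, n - 5, HalfTile.cut p q, q⟩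
  | ⟨.obtuse, n, p, q⟩ => ⟨.acute, n - 3, q, HalfTile.cut p q⟩

namespace GoldenTriangle

/-- The side `[u, v]` of a golden triangle of level `n`. -/
def cutEdge (n : ℕ) (T : GoldenTriangle) : Edge := ⟨T.shape, n + 3, T.u, T.v⟩

/-- The side `[u, w]` of a golden triangle of level `n`. -/
def leftEdge (n : ℕ) : GoldenTriangle → Edge
  | ⟨.acute, u, _, w, _⟩ => ⟨.obtuse, n + 2, w, u⟩
  | ⟨.obtuse, u, _, w, _⟩ => ⟨.acute, n + 2, u, w⟩

/-- The side `[v, w]` of a golden triangle of level `n`. -/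
def rightEdge (n : ℕ) : GoldenTriangle → Edge
  | ⟨.acute, _, v, w, _⟩ => ⟨.obtuse, n, v, w⟩
  | ⟨.obtuse, _, v, w, _⟩ => ⟨.obtuse, n + 1, v, w⟩

/-- The common side of the two parts of a golden triangle of level `n + 2`. -/
def innerEdge (n : ℕ) (T : GoldenTriangle) : Edge :=
  match T.shape with
  | .acute => ⟨.acute, n + 3, T.w, T.cut⟩
  | .obtuse => ⟨.obtuse, n + 1, T.w, T.cut⟩

/-- The sides of a golden triangle of level `n`. -/
def edges (n : ℕ) (T : GoldenTriangle) : Set Edge := {T.cutEdge n, T.leftEdge n, T.rightEdge n}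

variable (T : GoldenTriangle) (n : ℕ)

theorem edges_left :
    T.left.edges (n + 1) = {(T.cutEdge (n + 2)).left, T.leftEdge (n + 2), T.innerEdge n} := by
  obtain ⟨_ | _, u, v, w, _⟩ := T
  · exact (congrArg _ (Set.pair_comm _ _)).trans (Set.insert_comm _ _ _)
  · exact Set.insert_comm _ _ _

theorem edges_right :
    T.right.edges n = {(T.cutEdge (n + 2)).right, T.rightEdge (n + 2), T.innerEdge n} := by
  obtain ⟨_ | _, u, v, w, _⟩ := T
  · exact (Set.insert_comm _ _ _).trans
      ((congrArg _ (Set.pair_comm _ _)).trans (Set.insert_comm _ _ _))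
  · exact Set.insert_comm _ _ _

end GoldenTriangle

/-- The reparametrizations by which the equalizing maps act on the edges. -/
def edgeMap : Shape → ℕ → ℝ → ℝ
  | .acute, n + 5 => concat φ⁻¹ (fibRatio n) (edgeMap .obtuse (n + 2)) (edgeMap .obtuse n)
  | .obtuse, n + 5 =>
    concat φ⁻¹ (fibRatio n) (rev (edgeMap .obtuse (n + 3))) (rev (edgeMap .acute (n + 2)))
  | _, _ => id

theorem edgeMap_of_lt {s : Shape} {n : ℕ} (hn : n < 5) : edgeMap s n = id := by
  unfold edgeMap
  split <;> first | rfl | omega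

theorem isReparam_edgeMap (s : Shape) (n : ℕ) : IsReparam (edgeMap s n) := by
  induction n using Nat.strong_induction_on generalizing s with
  | _ n ih =>
    obtain hn | hn := lt_or_ge n 5
    · exact edgeMap_of_lt hn ▸ isReparam_id
    obtain ⟨n, rfl⟩ := Nat.exists_eq_add_of_le' hn
    cases s
    · exact isReparam_concat inv_goldenRatio_mem_Ioo (fibRatio_mem_Ioo n)
        (ih _ (by omega) _) (ih _ (by omega) _)
    · exact isReparam_concat inv_goldenRatio_mem_Ioo (fibRatio_mem_Ioo n)
        (ih _ (by omega) _).rev (ih _ (by omega) _).rev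

/-- `F` acts on an edge in the way prescribed by its type. -/
def ActsOnEdge (F : Plane → Plane) (e : Edge) : Prop := ActsOn F e.p e.q (edgeMap e.shape e.level)

namespace GoldenTriangle

variable {T : GoldenTriangle} {n : ℕ} {ρ : ℝ} {F F₁ F₂ : Plane → Plane}

theorem actsOnEdge_cutEdge
    (hF₁ : Set.EqOn F (slide φ⁻¹ (fibRatio n) T.u T.v T.w ∘ F₁) (triangle T.u T.cut T.w))
    (hF₂ : Set.EqOn F (slide φ⁻¹ (fibRatio n) T.u T.v T.w ∘ F₂) (triangle T.cut T.v T.w))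
    (a₁ : ActsOnEdge F₁ (T.cutEdge (n + 2)).left) (a₂ : ActsOnEdge F₂ (T.cutEdge (n + 2)).right) :
    ActsOnEdge F (T.cutEdge (n + 2)) := by
  have h := T.doubleArea_ne_zero
  obtain ⟨_ | _, u, v, w, _⟩ := T
  · exact actsOn_concat h inv_goldenRatio_mem_Ioo hF₁ hF₂ (isReparam_edgeMap _ _)
      (isReparam_edgeMap _ _) a₁ a₂
  · exact actsOn_concat h inv_goldenRatio_mem_Ioo hF₁ hF₂ (isReparam_edgeMap _ _).rev
      (isReparam_edgeMap _ _).rev a₁.rev a₂.rev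

theorem actsOnEdge_leftEdge
    (hF : Set.EqOn F (slide φ⁻¹ ρ T.u T.v T.w ∘ F₁) (triangle T.u T.cut T.w))
    (a : ActsOnEdge F₁ (T.leftEdge n)) : ActsOnEdge F (T.leftEdge n) := by
  have h := T.doubleArea_ne_zero
  obtain ⟨_ | _, u, v, w, _⟩ := T
  · have := (actsOn_left_apex h inv_goldenRatio_mem_Ioo hF (isReparam_edgeMap _ _).rev a.rev).rev
    rwa [rev_rev] at this
  · exact actsOn_left_apex h inv_goldenRatio_mem_Ioo hF (isReparam_edgeMap _ _) a

theorem actsOnEdge_rightEdge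
    (hF : Set.EqOn F (slide φ⁻¹ ρ T.u T.v T.w ∘ F₂) (triangle T.cut T.v T.w))
    (a : ActsOnEdge F₂ (T.rightEdge n)) : ActsOnEdge F (T.rightEdge n) := by
  have h := T.doubleArea_ne_zero
  obtain ⟨_ | _, u, v, w, _⟩ := T <;>
    exact actsOn_right_apex h inv_goldenRatio_mem_Ioo hF (isReparam_edgeMap _ _) a

end GoldenTriangle

end Edges

section Equalizer

namespace GoldenTriangle

/-- `F` is a bi-Lipschitz self-map of `T` with inverse `G` that is affine on the half tiles of the
dissection of level `n` and maps all of them to triangles of the same area. -/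
structure IsEqualizer (n : ℕ) (T : GoldenTriangle) (F G : Plane → Plane) : Prop where
  biLipOn : BiLipOn (lipConst n) T.region T.region F G
  actsOnEdge : ∀ e ∈ T.edges n, ActsOnEdge F e
  affine : ∀ t, IsLeaf n T t →
    IsAffineOnWithDet F t.region (T.area / (Nat.fib (n + 1) * volume.real t.region))

variable {T : GoldenTriangle} {n : ℕ} {F F₁ F₂ G : Plane → Plane}

theorem isEqualizer_id (T : GoldenTriangle) (hn : n < 2) : IsEqualizer n T id id where
  biLipOn := (BiLipOn.id _).weaken (lipConst_mono n.zero_le)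
  actsOnEdge e he := by
    have hlevel : e.level < 5 := by
      obtain ⟨_ | _, u, v, w, _⟩ := T <;> obtain rfl | rfl | rfl := he <;>
        simp only [cutEdge, leftEdge, rightEdge] <;> omega
    rw [ActsOnEdge, edgeMap_of_lt hlevel]
    exact actsOn_id _ _
  affine t ht := by
    have hfib : Nat.fib (n + 1) = 1 := by interval_cases n <;> rfl
    have hregion : t.region = T.region := by
      cases ht
      exacts [T.region_tile₀, T.region_tile₁, absurd hn (by omega), absurd hn (by omega)]
    rw [hfib, hregion, Nat.cast_one, one_mul, ← area, div_self T.area_pos.ne']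
    exact .id _

theorem det_mul_area_div {κ r A N V : ℝ} (hκ : κ ≠ 0) (hr : r ≠ 0) :
    r / κ * (κ * A / (r * N * V)) = A / (N * V) := by field_simp

theorem IsEqualizer.affine_left {F₁ G₁ : Plane → Plane} (h₁ : IsEqualizer (n + 1) T.left F₁ G₁)
    (hF : Set.EqOn F (slide φ⁻¹ (fibRatio n) T.u T.v T.w ∘ F₁) (triangle T.u T.cut T.w))
    {t : HalfTile} (ht : IsLeaf (n + 1) T.left t) :
    IsAffineOnWithDet F t.region (T.area / (Nat.fib (n + 3) * volume.real t.region)) := by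
  have hsub := ht.region_subset
  have hslide := isAffineOnWithDet_slide_left (κ' := fibRatio n) T.doubleArea_ne_zero
    inv_goldenRatio_mem_Ioo
  have hcomp := hslide.comp (h₁.affine t ht) ((h₁.biLipOn.mapsTo.mono_left hsub).mono_right
    T.region_left.subset)
  rw [area_left, ← fibRatio_mul_fib, det_mul_area_div inv_goldenRatio_mem_Ioo.1.ne'
    (fibRatio_mem_Ioo n).1.ne'] at hcomp
  exact hcomp.congr (hF.mono (hsub.trans T.region_left.subset))

theorem IsEqualizer.affine_right {F₂ G₂ : Plane → Plane} (h₂ : IsEqualizer n T.right F₂ G₂)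
    (hF : Set.EqOn F (slide φ⁻¹ (fibRatio n) T.u T.v T.w ∘ F₂) (triangle T.cut T.v T.w))
    {t : HalfTile} (ht : IsLeaf n T.right t) :
    IsAffineOnWithDet F t.region (T.area / (Nat.fib (n + 3) * volume.real t.region)) := by
  have hsub := ht.region_subset
  have hslide := isAffineOnWithDet_slide_right (κ' := fibRatio n) T.doubleArea_ne_zero
    inv_goldenRatio_mem_Ioo
  have hcomp := hslide.comp (h₂.affine t ht) ((h₂.biLipOn.mapsTo.mono_left hsub).mono_right
    T.region_right.subset)
  rw [area_right, ← one_sub_fibRatio_mul_fib, det_mul_area_div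
    (sub_pos.2 inv_goldenRatio_mem_Ioo.2).ne' (sub_pos.2 (fibRatio_mem_Ioo n).2).ne'] at hcomp
  exact hcomp.congr (hF.mono (hsub.trans T.region_right.subset))

theorem exists_biLipOn_slide_comp {F₁ G₁ F₂ G₂ : Plane → Plane}
    (h₁ : IsEqualizer (n + 1) T.left F₁ G₁) (h₂ : IsEqualizer n T.right F₂ G₂) :
    ∃ F G, BiLipOn (lipConst (n + 2)) T.region T.region F G ∧
      Set.EqOn F (slide φ⁻¹ (fibRatio n) T.u T.v T.w ∘ F₁) (triangle T.u T.cut T.w) ∧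
      Set.EqOn F (slide φ⁻¹ (fibRatio n) T.u T.v T.w ∘ F₂) (triangle T.cut T.v T.w) := by
  have biLip₁ := T.region_left ▸ h₁.biLipOn
  have biLip₂ := T.region_right ▸ h₂.biLipOn.weaken (lipConst_le_succ n)
  have inner₁ : ActsOnEdge F₁ (T.innerEdge n) := h₁.actsOnEdge _ (by rw [edges_left]; simp)
  have inner₂ : ActsOnEdge F₂ (T.innerEdge n) := h₂.actsOnEdge _ (by rw [edges_right]; simp)
  have hε : |fibRatio n - φ⁻¹| ≤ (((φ⁻¹ : ℝ).toNNReal ^ (n + 1) : ℝ≥0) : ℝ) := by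
    rw [NNReal.coe_pow, Real.coe_toNNReal _ inv_goldenRatio_mem_Ioo.1.le]
    exact abs_fibRatio_sub_le n
  have hL : (1 + 3 * 2 * (φ⁻¹ : ℝ).toNNReal ^ (n + 1)) * lipConst (n + 1) = lipConst (n + 2) := by
    rw [lipConst, lipConst, Finset.prod_range_succ _ (n + 1), mul_comm]
    norm_num
  have hinner : ∃ e, IsReparam e ∧ ActsOn F₁ T.w T.cut e ∧ ActsOn F₂ T.w T.cut e := by
    obtain ⟨_ | _, u, v, w, _⟩ := T <;> exact ⟨_, isReparam_edgeMap _ _, inner₁, inner₂⟩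
  obtain ⟨e, he, a₁, a₂⟩ := hinner
  exact hL ▸ exists_biLipOn_slide T.doubleArea_ne_zero inv_goldenRatio_mem_Icc (fibRatio_mem_Icc n)
    T.dist_mul_dist_le T.dist_mul_dist_le' hε biLip₁ biLip₂ he a₁ a₂

theorem exists_isEqualizer_add_two (h₁ : ∃ F G, IsEqualizer (n + 1) T.left F G)
    (h₂ : ∃ F G, IsEqualizer n T.right F G) : ∃ F G, IsEqualizer (n + 2) T F G := by
  obtain ⟨F₁, G₁, h₁⟩ := h₁
  obtain ⟨F₂, G₂, h₂⟩ := h₂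
  obtain ⟨F, G, hFG, hF₁, hF₂⟩ := exists_biLipOn_slide_comp h₁ h₂
  have acts₁ := h₁.actsOnEdge
  have acts₂ := h₂.actsOnEdge
  rw [edges_left] at acts₁
  rw [edges_right] at acts₂
  refine ⟨F, G, hFG, ?_, ?_⟩
  · rintro _ (rfl | rfl | rfl)
    · exact actsOnEdge_cutEdge hF₁ hF₂ (acts₁ _ (.inl rfl)) (acts₂ _ (.inl rfl))
    · exact actsOnEdge_leftEdge hF₁ (acts₁ _ (.inr (.inl rfl)))
    · exact actsOnEdge_rightEdge hF₂ (acts₂ _ (.inr (.inl rfl)))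
  · rintro t (_ | _ | ht | ht)
    exacts [h₁.affine_left hF₁ ht, h₂.affine_right hF₂ ht]

theorem exists_isEqualizer (n : ℕ) (T : GoldenTriangle) : ∃ F G, IsEqualizer n T F G := by
  induction n using Nat.twoStepInduction generalizing T with
  | zero => exact ⟨id, id, isEqualizer_id T zero_lt_two⟩
  | one => exact ⟨id, id, isEqualizer_id T one_lt_two⟩
  | more n ih₂ ih₁ => exact exists_isEqualizer_add_two (ih₁ _) (ih₂ _)

end GoldenTriangle

end Equalizer

section Partner

/-- `e.HasAxis k b c` says that, after the side `e` is fully subdivided, one of its pieces is the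
axis `[b, c]` of a half tile of kind `k`. -/
inductive Edge.HasAxis : Edge → Kind → Plane → Plane → Prop
  | halfKite (p q : Plane) : HasAxis ⟨.acute, 4, p, q⟩ .halfKite p q
  | halfDart (p q : Plane) : HasAxis ⟨.acute, 2, p, q⟩ .halfDart q p
  | halfThick (p q : Plane) : HasAxis ⟨.obtuse, 4, p, q⟩ .halfThick p q
  | halfThin (p q : Plane) : HasAxis ⟨.obtuse, 0, p, q⟩ .halfThin p q
  | left {e : Edge} {k : Kind} {b c : Plane} :
    5 ≤ e.level → HasAxis e.left k b c → HasAxis e k b c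
  | right {e : Edge} {k : Kind} {b c : Plane} :
    5 ≤ e.level → HasAxis e.right k b c → HasAxis e k b c

namespace Edge

/-- The closed segment of an edge. -/
def carrier (e : Edge) : Set Plane := segment ℝ e.p e.q

theorem cut_mem_segment (p q : Plane) : HalfTile.cut p q ∈ segment ℝ p q :=
  segment_eq_image_lineMap ℝ p q ▸ ⟨φ⁻¹, Set.Ioo_subset_Icc_self inv_goldenRatio_mem_Ioo, rfl⟩

theorem carrier_left_subset (e : Edge) : e.left.carrier ⊆ e.carrier := by
  obtain ⟨_ | _, n, p, q⟩ := e
  exacts [(convex_segment p q).segment_subset (left_mem_segment ℝ p q) (cut_mem_segment p q),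
    (convex_segment p q).segment_subset (cut_mem_segment p q) (left_mem_segment ℝ p q)]

theorem carrier_right_subset (e : Edge) : e.right.carrier ⊆ e.carrier := by
  obtain ⟨_ | _, n, p, q⟩ := e
  exacts [(convex_segment p q).segment_subset (cut_mem_segment p q) (right_mem_segment ℝ p q),
    (convex_segment p q).segment_subset (right_mem_segment ℝ p q) (cut_mem_segment p q)]

variable {e : Edge} {k : Kind} {b c : Plane}

theorem HasAxis.mem_carrier (h : e.HasAxis k b c) : b ∈ e.carrier := by
  induction h with
  | halfKite p q | halfThick p q | halfThin p q => exact left_mem_segment ℝ p q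
  | halfDart p q => exact right_mem_segment ℝ p q
  | left _ _ ih => exact carrier_left_subset _ ih
  | right _ _ ih => exact carrier_right_subset _ ih

theorem HasAxis.left_or_right (h : e.HasAxis k b c) (he : 5 ≤ e.level) :
    e.left.HasAxis k b c ∨ e.right.HasAxis k b c := by
  cases h with
  | left _ h => exact .inl h
  | right _ h => exact .inr h
  | _ => exact absurd he (by norm_num)

end Edge

/-- The two half tiles have the same kind and the same axis `[b, c]`, so that they are the halves
of one whole tile. -/
structure IsPartner (t t' : HalfTile) : Prop where
  ne : t ≠ t'
  kind_eq : t'.kind = t.kind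
  b_eq : t'.b = t.b
  c_eq : t'.c = t.c

namespace GoldenTriangle

variable {T : GoldenTriangle} {n : ℕ} {t : HalfTile} {e : Edge} {k : Kind} {b c : Plane}

theorem disjoint_interior_left_right (T : GoldenTriangle) :
    Disjoint (interior T.left.region) (interior T.right.region) := by
  rw [region_left, region_right]
  exact disjoint_interior_parts T.doubleArea_ne_zero inv_goldenRatio_mem_Ioo

theorem IsLeaf.interior_region_nonempty (ht : IsLeaf n T t) : (interior t.region).Nonempty := by
  induction ht with
  | tile₀ T => exact T.region_tile₀ ▸ interior_triangle_nonempty T.doubleArea_ne_zero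
  | tile₁ T => exact T.region_tile₁ ▸ interior_triangle_nonempty T.doubleArea_ne_zero
  | left _ ih => exact ih
  | right _ ih => exact ih

theorem IsLeaf.ne_of_left_of_right {m : ℕ} {t' : HalfTile} (ht : IsLeaf n T.left t)
    (ht' : IsLeaf m T.right t') : t ≠ t' := by
  rintro rfl
  exact ht.interior_region_nonempty.ne_empty (disjoint_self.1
    (T.disjoint_interior_left_right.mono (interior_mono ht.region_subset)
      (interior_mono ht'.region_subset)))

theorem exists_isLeaf_of_hasAxis (he : e ∈ T.edges n) (h : e.HasAxis k b c) :
    ∃ t, IsLeaf n T t ∧ t.kind = k ∧ t.b = b ∧ t.c = c := by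
  induction n using Nat.twoStepInduction generalizing T e with
  | zero =>
    refine ⟨_, .tile₀ T, ?_⟩
    obtain ⟨_ | _, u, v, w, _⟩ := T <;> obtain rfl | rfl | rfl := he <;> cases h <;>
      first | exact ⟨rfl, rfl, rfl⟩ | contradiction
  | one =>
    refine ⟨_, .tile₁ T, ?_⟩
    obtain ⟨_ | _, u, v, w, _⟩ := T <;> obtain rfl | rfl | rfl := he <;> cases h <;>
      first | exact ⟨rfl, rfl, rfl⟩ | contradiction
  | more n ih₂ ih₁ =>
    have left {e} (he : e ∈ T.left.edges (n + 1)) (h : e.HasAxis k b c) :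
        ∃ t, IsLeaf (n + 2) T t ∧ t.kind = k ∧ t.b = b ∧ t.c = c :=
      (ih₁ he h).imp fun _ ht => ⟨ht.1.left, ht.2⟩
    have right {e} (he : e ∈ T.right.edges n) (h : e.HasAxis k b c) :
        ∃ t, IsLeaf (n + 2) T t ∧ t.kind = k ∧ t.b = b ∧ t.c = c :=
      (ih₂ he h).imp fun _ ht => ⟨ht.1.right, ht.2⟩
    rw [edges_left] at left
    rw [edges_right] at right
    obtain rfl | rfl | rfl := he
    · obtain h | h := h.left_or_right (Nat.le_add_left 5 n)
      exacts [left (.inl rfl) h, right (.inl rfl) h]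
    · exact left (.inr (.inl rfl)) h
    · exact right (.inr (.inl rfl)) h

theorem IsLeaf.exists_hasAxis_or_exists_isPartner (ht : IsLeaf n T t) :
    (∃ e ∈ T.edges n, e.HasAxis t.kind t.b t.c) ∨ ∃ t', IsLeaf n T t' ∧ IsPartner t t' := by
  induction ht with
  | tile₀ T =>
    obtain ⟨_ | _, u, v, w, _⟩ := T
    exacts [.inl ⟨_, .inr (.inr rfl), .halfThin _ _⟩, .inl ⟨_, .inr (.inl rfl), .halfDart _ _⟩]
  | tile₁ T =>
    obtain ⟨_ | _, u, v, w, _⟩ := T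
    exacts [.inl ⟨_, .inl rfl, .halfKite _ _⟩, .inl ⟨_, .inl rfl, .halfThick _ _⟩]
  | @left n T t ht ih =>
    obtain ⟨e, he, h⟩ | ⟨t', ht', h⟩ := ih
    · obtain rfl | rfl | rfl := edges_left T n ▸ he
      · exact .inl ⟨_, .inl rfl, .left (Nat.le_add_left 5 n) h⟩
      · exact .inl ⟨_, .inr (.inl rfl), h⟩
      · have inner_mem : T.innerEdge n ∈ T.right.edges n := by rw [edges_right]; simp
        obtain ⟨t', ht', hk, hb, hc⟩ := exists_isLeaf_of_hasAxis inner_mem h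
        exact .inr ⟨t', ht'.right, ht.ne_of_left_of_right ht', hk, hb, hc⟩
    · exact .inr ⟨t', ht'.left, h⟩
  | @right n T t ht ih =>
    obtain ⟨e, he, h⟩ | ⟨t', ht', h⟩ := ih
    · obtain rfl | rfl | rfl := edges_right T n ▸ he
      · exact .inl ⟨_, .inl rfl, .right (Nat.le_add_left 5 n) h⟩
      · exact .inl ⟨_, .inr (.inr rfl), h⟩
      · have inner_mem : T.innerEdge n ∈ T.left.edges (n + 1) := by rw [edges_left]; simp
        obtain ⟨t', ht', hk, hb, hc⟩ := exists_isLeaf_of_hasAxis inner_mem h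
        exact .inr ⟨t', ht'.left, (ht'.ne_of_left_of_right ht).symm, hk, hb, hc⟩
    · exact .inr ⟨t', ht'.right, h⟩

theorem frontier_region (T : GoldenTriangle) (n : ℕ) :
    frontier T.region = ⋃ e ∈ T.edges n, e.carrier := by
  have biUnion_edges : ⋃ e ∈ T.edges n, e.carrier =
      (T.cutEdge n).carrier ∪ ((T.leftEdge n).carrier ∪ (T.rightEdge n).carrier) := by
    rw [edges, Set.biUnion_insert, Set.biUnion_insert, Set.biUnion_singleton]
  rw [biUnion_edges, region, frontier_triangle T.doubleArea_ne_zero, ← Set.union_assoc]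
  obtain ⟨_ | _, u, v, w, _⟩ := T
  · rfl
  · simp only [Edge.carrier, cutEdge, leftEdge, rightEdge, segment_symm ℝ u w]

theorem IsLeaf.exists_isPartner (ht : IsLeaf n T t) (hb : t.b ∈ interior T.region) :
    ∃ t', IsLeaf n T t' ∧ IsPartner t t' :=
  ht.exists_hasAxis_or_exists_isPartner.resolve_left fun ⟨_, he, h⟩ =>
    (T.frontier_region n ▸ Set.mem_biUnion he h.mem_carrier : t.b ∈ frontier T.region).2 hb

end GoldenTriangle

end Partner

section Normalization

theorem ball_subset_of_corners {S : Set Plane} (hS : Convex ℝ S) {R : ℝ} (h₁ : !₂[R, R] ∈ S)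
    (h₂ : !₂[-R, R] ∈ S) (h₃ : !₂[R, -R] ∈ S) (h₄ : !₂[-R, -R] ∈ S) : Metric.ball 0 R ⊆ S := by
  intro x hx
  have hR : 0 < R := Metric.pos_of_mem_ball hx
  have hx_coord (i : Fin 2) : |x i| ≤ R :=
    (PiLp.norm_apply_le x i).trans (mem_ball_zero_iff.1 hx).le
  have ratio_mem (i : Fin 2) : (1 + x i / R) / 2 ∈ Set.Icc (0 : ℝ) 1 := by
    obtain ⟨lower, upper⟩ := abs_le.1 (hx_coord i)
    have lower' : -1 ≤ x i / R := (le_div_iff₀ hR).2 (by linarith)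
    have upper' : x i / R ≤ 1 := (div_le_one hR).2 upper
    constructor <;> linarith
  have hmem := hS.lineMap_mem (hS.lineMap_mem h₄ h₃ (ratio_mem 0))
    (hS.lineMap_mem h₂ h₁ (ratio_mem 0)) (ratio_mem 1)
  convert hmem using 1
  ext i
  fin_cases i <;> simp [lineMap_coord] <;> field_simp <;> ring

namespace GoldenTriangle

variable {T : GoldenTriangle} {n : ℕ} {t t' : HalfTile}

theorem IsLeaf.disjoint_interior (ht : IsLeaf n T t) (ht' : IsLeaf n T t') (hne : t ≠ t') :
    Disjoint (interior t.region) (interior t'.region) := by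
  induction ht with
  | tile₀ T =>
    cases ht'
    exact absurd rfl hne
  | tile₁ T =>
    cases ht'
    exact absurd rfl hne
  | left ht ih =>
    cases ht' with
    | left ht' => exact ih ht' hne
    | right ht' =>
      exact (disjoint_interior_left_right _).mono (interior_mono ht.region_subset)
        (interior_mono ht'.region_subset)
  | right ht ih =>
    cases ht' with
    | left ht' =>
      exact (disjoint_interior_left_right _).symm.mono
        (interior_mono ht.region_subset) (interior_mono ht'.region_subset)
    | right ht' => exact ih ht' hne

theorem IsLeaf.volume_real_pos (ht : IsLeaf n T t) : 0 < volume.real t.region := by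
  induction ht with
  | tile₀ T => exact T.region_tile₀ ▸ T.area_pos
  | tile₁ T => exact T.region_tile₁ ▸ T.area_pos
  | left _ ih => exact ih
  | right _ ih => exact ih

theorem IsLeaf.area_div_fib_mem_Icc (ht : IsLeaf n T t) :
    T.area / Nat.fib (n + 1) ∈ Set.Icc (volume.real t.region / 2) (2 * volume.real t.region) := by
  obtain ⟨k, hk, harea⟩ := ht.exists_volume_real_mul_pow_eq
  have lower := cast_fib_succ_le_goldenRatio_pow n
  have upper := goldenRatio_pow_le_two_mul_cast_fib_succ n
  have one_le : 1 ≤ φ ^ k := one_le_pow₀ Real.one_lt_goldenRatio.le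
  have le_two : φ ^ k ≤ 2 := (pow_le_pow_right₀ Real.one_lt_goldenRatio.le hk).trans
    ((pow_one φ).trans_le Real.goldenRatio_lt_two.le)
  have hT := T.area_pos.le
  have ht : 0 ≤ volume.real t.region := measureReal_nonneg
  rw [Set.mem_Icc, le_div_iff₀ (cast_fib_succ_pos n), div_le_iff₀ (cast_fib_succ_pos n)]
  constructor <;> nlinarith

theorem IsEqualizer.mapsTo_frontier {F G : Plane → Plane} (h : IsEqualizer n T F G) :
    Set.MapsTo G (frontier T.region) (frontier T.region) := by
  have frontier_subset : frontier T.region ⊆ T.region :=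
    (isClosed_triangle T.u T.v T.w).frontier_subset
  rw [T.frontier_region n] at frontier_subset ⊢
  refine Set.mapsTo_iUnion₂.2 fun e he => Set.MapsTo.mono_right ?_ (Set.subset_biUnion_of_mem he)
  exact mapsTo_symm_segment_of_actsOn h.biLipOn (isReparam_edgeMap _ _) (h.actsOnEdge e he)
    ((Set.subset_biUnion_of_mem he).trans frontier_subset)

/-- A bi-Lipschitz map of a golden triangle that fixes the origin, is affine on the half tiles of
the dissection of level `n`, and gives each of them the image area `1 / c`. By the last field the
images exhaust the plane if the triangles do. -/
structure IsNormalizedEqualizer (n : ℕ) (T : GoldenTriangle) (c : ℝ) (K : ℝ≥0) (S' : Set Plane)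
    (F G : Plane → Plane) : Prop where
  biLipOn : BiLipOn K T.region S' F G
  map_zero : F 0 = 0
  affine : ∀ t, IsLeaf n T t → IsAffineOnWithDet F t.region (1 / (c * volume.real t.region))
  ball_subset : ∀ R, Metric.ball 0 R ⊆ T.region → Metric.ball 0 (R / K) ⊆ S'

theorem IsEqualizer.exists_isNormalizedEqualizer {F G : Plane → Plane} (h : IsEqualizer n T F G)
    {c : ℝ} {K M : ℝ≥0} (hc : 0 < c) (hK : lipConst n ≤ K)
    (hM : √(c * (T.area / Nat.fib (n + 1))) ≤ M)
    (hM' : (√(c * (T.area / Nat.fib (n + 1))))⁻¹ ≤ M) :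
    ∃ S' F' G', IsNormalizedEqualizer n T c (M * K) S' F' G' := by
  set V := T.area / Nat.fib (n + 1) with hV
  have hV₀ : 0 < V := div_pos T.area_pos (cast_fib_succ_pos n)
  obtain ⟨e, he₀, he, he', he_affine⟩ := exists_homeomorph_smul_sub (F 0)
    (inv_pos.2 (Real.sqrt_pos.2 (mul_pos hc hV₀))) hM' ((inv_inv √(c * V)).trans_le hM)
  have biLipOn := (BiLipOn.of_homeomorph e he he' T.region).comp (h.biLipOn.weaken hK)
  refine ⟨e '' T.region, e ∘ F, G ∘ e.symm, biLipOn, he₀, fun t ht => ?_, fun R hR => ?_⟩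
  · convert (he_affine T.region).comp (h.affine t ht)
      (h.biLipOn.mapsTo.mono_left ht.region_subset) using 1
    rw [finrank_euclideanSpace_fin, inv_pow, Real.sq_sqrt (mul_pos hc hV₀).le,
      ← div_div (T.area), ← hV]
    field_simp
  · have mapsTo_frontier :
        Set.MapsTo (G ∘ e.symm) (frontier (e '' T.region)) (frontier T.region) := by
      rw [← e.image_frontier]
      rintro _ ⟨x, hx, rfl⟩
      rw [Function.comp_apply, e.symm_apply_apply]
      exact h.mapsTo_frontier hx
    have ball_subset := biLipOn.ball_subset
      (e.isClosed_image.2 (isClosed_triangle T.u T.v T.w)) mapsTo_frontier hR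
    rwa [Function.comp_apply, he₀] at ball_subset

theorem exists_isNormalizedEqualizer {t : HalfTile} {c : ℝ} (hc : 0 < c) :
    ∃ K > 0, ∀ n T, IsLeaf n T t → ∃ S' F G, IsNormalizedEqualizer n T c K S' F G := by
  obtain ⟨K, hK₀, hK⟩ := exists_lipConst_le
  set v := volume.real t.region
  let M : ℝ≥0 := 1 ⊔ (√(c * (2 * v))).toNNReal ⊔ (√(c * (v / 2)))⁻¹.toNNReal
  have upper_le : √(c * (2 * v)) ≤ M := (Real.le_coe_toNNReal _).trans
    (NNReal.coe_le_coe.2 (le_sup_of_le_left le_sup_right))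
  have lower_le : (√(c * (v / 2)))⁻¹ ≤ M := (Real.le_coe_toNNReal _).trans
    (NNReal.coe_le_coe.2 le_sup_right)
  have hM : 0 < M := zero_lt_one.trans_le (le_sup_of_le_left le_sup_left)
  refine ⟨M * K, mul_pos hM hK₀, fun n T ht => ?_⟩
  obtain ⟨F, G, hFG⟩ := exists_isEqualizer n T
  obtain ⟨lower, upper⟩ := ht.area_div_fib_mem_Icc
  have hv₀ : 0 < v := ht.volume_real_pos
  refine hFG.exists_isNormalizedEqualizer hc (hK n) (le_trans ?_ upper_le) (le_trans ?_ lower_le)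
  · gcongr
  · gcongr

end GoldenTriangle

end Normalization

section Tiling

theorem frontier_region_null (t : HalfTile) : volume (frontier t.region) = 0 :=
  (convex_triangle t.a t.b t.c).addHaar_frontier volume

namespace IsHalfTileTiling

variable {σ : Set HalfTile} {t t' : HalfTile} {x : Plane}

theorem exists_mem (hσ : IsHalfTileTiling σ) (x : Plane) : ∃ t ∈ σ, x ∈ t.region := by
  simpa using hσ.cover.superset (Set.mem_univ x)

theorem exists_patch (hσ : IsHalfTileTiling σ) (P : Finset σ) :
    ∃ n T, ∀ t ∈ P, GoldenTriangle.IsLeaf n T t := by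
  obtain ⟨s, m, hs, hP⟩ := hσ.patch (Subtype.val '' (P : Set σ))
    (Subtype.coe_image_subset σ _) (P.finite_toSet.image _)
  obtain ⟨n, T, hsT⟩ := GoldenTriangle.exists_isLeaf_of_isWellShaped hs
  exact ⟨n + 2 * m, T, fun t ht => hsT.of_mem_descendants (hP (Set.mem_image_of_mem _ ht))⟩

theorem exists_isLeaf (hσ : IsHalfTileTiling σ) (ht : t ∈ σ) :
    ∃ n T, GoldenTriangle.IsLeaf n T t := by
  obtain ⟨n, T, h⟩ := hσ.exists_patch {⟨t, ht⟩}
  exact ⟨n, T, h _ (Finset.mem_singleton_self _)⟩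

theorem isWellShaped (hσ : IsHalfTileTiling σ) (ht : t ∈ σ) : t.IsWellShaped :=
  let ⟨_, _, h⟩ := hσ.exists_isLeaf ht
  h.isWellShaped

theorem interior_region_nonempty (hσ : IsHalfTileTiling σ) (ht : t ∈ σ) :
    (interior t.region).Nonempty :=
  let ⟨_, _, h⟩ := hσ.exists_isLeaf ht
  h.interior_region_nonempty

theorem exists_finset_ball_subset (hσ : IsHalfTileTiling σ) (R : ℝ) :
    ∃ P : Finset σ, ∀ n T, (∀ t ∈ P, GoldenTriangle.IsLeaf n T t) →
      Metric.ball 0 R ⊆ T.region := by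
  classical
  choose tile tile_mem mem_tile using hσ.exists_mem
  refine ⟨Finset.image (fun x => ⟨tile x, tile_mem x⟩)
    {!₂[R, R], !₂[-R, R], !₂[R, -R], !₂[-R, -R]}, fun n T h => ?_⟩
  rw [Finset.forall_mem_image] at h
  have corner_mem {x : Plane} (hx : x ∈ ({!₂[R, R], !₂[-R, R], !₂[R, -R], !₂[-R, -R]} :
      Finset Plane)) : x ∈ T.region := (h hx).region_subset (mem_tile x)
  apply ball_subset_of_corners (convex_triangle T.u T.v T.w) <;> exact corner_mem (by simp)

open Filter in
theorem exists_homeomorph (hσ : IsHalfTileTiling σ) {c : ℝ} (hc : 0 < c) :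
    ∃ Φ : Plane ≃ₜ Plane, (∃ K, LipschitzWith K Φ ∧ LipschitzWith K Φ.symm) ∧
      ∀ t ∈ σ, IsAffineOnWithDet Φ t.region (1 / (c * volume.real t.region)) := by
  classical
  obtain ⟨t₀, ht₀, -⟩ := hσ.exists_mem 0
  obtain ⟨K, hK, exists_equalizer⟩ :=
    GoldenTriangle.exists_isNormalizedEqualizer (t := t₀) hc
  have exists_equalizer_of_patch (P : Finset σ) : ∃ n T S' F G,
      GoldenTriangle.IsNormalizedEqualizer n T c K S' F G ∧
        ∀ t ∈ P, GoldenTriangle.IsLeaf n T t := by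
    obtain ⟨n, T, hP⟩ := hσ.exists_patch (insert ⟨t₀, ht₀⟩ P)
    obtain ⟨S', F, G, h⟩ := exists_equalizer n T (hP _ (Finset.mem_insert_self _ _))
    exact ⟨n, T, S', F, G, h, fun t ht => hP t (Finset.mem_insert_of_mem ht)⟩
  choose n T S' F G h isLeaf using exists_equalizer_of_patch
  let U : Ultrafilter (Finset σ) := Ultrafilter.of atTop
  have eventually_subset (Q : Finset σ) : ∀ᶠ P in U, Q ⊆ P :=
    Ultrafilter.of_le atTop (eventually_ge_atTop Q)
  have eventually_ball_subset (R : ℝ) : ∀ᶠ P in U, Metric.ball 0 R ⊆ (T P).region := by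
    obtain ⟨Q, hQ⟩ := hσ.exists_finset_ball_subset R
    filter_upwards [eventually_subset Q] with P hQP
    exact hQ _ _ fun t ht => isLeaf P t (hQP ht)
  have mem_ball (x : Plane) : x ∈ Metric.ball 0 (‖x‖ + 1) := by simp
  obtain ⟨Φ, hΦ, hΦ', tendsto_Φ⟩ := exists_homeomorph_tendsto (U := U)
    (fun x => (eventually_ball_subset (‖x‖ + 1)).mono fun P hP => hP (mem_ball x))
    (fun y => (eventually_ball_subset ((‖y‖ + 1) * K)).mono fun P hP => by
      have image_ball := (h P).ball_subset _ hP
      rw [mul_div_cancel_right₀ _ (NNReal.coe_pos.2 hK).ne'] at image_ball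
      exact image_ball (mem_ball y))
    (fun P => (h P).biLipOn) (fun P => (h P).map_zero)
  refine ⟨Φ, ⟨K, hΦ, hΦ'⟩, fun t ht => ?_⟩
  have eventually_isLeaf : ∀ᶠ P in U, GoldenTriangle.IsLeaf (n P) (T P) t :=
    (eventually_subset {⟨t, ht⟩}).mono fun P hP =>
      isLeaf P _ (Finset.singleton_subset_iff.1 hP)
  exact .of_tendsto (hσ.interior_region_nonempty ht)
    (eventually_isLeaf.mono fun P hP => hP.region_subset) (fun P => (h P).biLipOn.lipschitz)
    (eventually_isLeaf.mono fun P hP => (h P).affine t hP) tendsto_Φ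

theorem eq_of_mem (hσ : IsHalfTileTiling σ) (ht : t ∈ σ) (ht' : t' ∈ σ)
    (hx : x ∈ interior t.region) (hx' : x ∈ t'.region) : t = t' := by
  by_contra hne
  have mem_closure : x ∈ closure (interior t'.region) :=
    ((convex_triangle t'.a t'.b t'.c).closure_interior_eq_closure_of_nonempty_interior
      (hσ.interior_region_nonempty ht')).superset (subset_closure hx')
  obtain ⟨y, hy, hy'⟩ := mem_closure_iff.1 mem_closure _ isOpen_interior hx
  exact Set.disjoint_left.1 (hσ.disjoint ht ht' hne) hy hy'

theorem countable (hσ : IsHalfTileTiling σ) : σ.Countable :=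
  Set.PairwiseDisjoint.countable_of_isOpen (s := fun t : HalfTile => interior t.region)
    hσ.disjoint (fun _ _ => isOpen_interior) fun _ ht => hσ.interior_region_nonempty ht

theorem ae_mem_interior (hσ : IsHalfTileTiling σ) :
    ∀ᵐ x : Plane, ∃ t ∈ σ, x ∈ interior t.region := by
  have notMem_frontier : ∀ᵐ x : Plane, ∀ t ∈ σ, x ∉ frontier t.region :=
    (ae_ball_iff hσ.countable).2 fun t _ =>
      measure_eq_zero_iff_ae_notMem.1 (frontier_region_null t)
  filter_upwards [notMem_frontier] with x hx
  obtain ⟨t, ht, hxt⟩ := hσ.exists_mem x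
  exact ⟨t, ht, by_contra fun hxt' => hx t ht ⟨subset_closure hxt, hxt'⟩⟩

end IsHalfTileTiling

theorem tilingFun_eq_of_forall {τ : Set (Set Plane)} {x : Plane} {A : ℝ}
    (h : ∃ T ∈ τ, x ∈ interior T) (hA : ∀ T ∈ τ, x ∈ interior T → volume.real T = A) :
    tilingFun τ x = 1 / A := by
  rw [tilingFun, dif_pos h, ← measureReal_def, hA _ h.choose_spec.1 h.choose_spec.2]

theorem IsHalfTileTiling.tilingFun_triangles {σ : Set HalfTile} {t : HalfTile} {x : Plane}
    (hσ : IsHalfTileTiling σ) (ht : t ∈ σ) (hx : x ∈ interior t.region) :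
    tilingFun (triangles σ) x = 1 / volume.real t.region := by
  refine tilingFun_eq_of_forall ⟨_, ⟨t, ht, rfl⟩, hx⟩ ?_
  rintro _ ⟨t', ht', rfl⟩ hx'
  rw [hσ.eq_of_mem ht ht' hx (interior_subset hx')]

end Tiling

section WholeTiles

theorem HalfTile.IsWellShaped.b_ne_c {t : HalfTile} (ht : t.IsWellShaped) : t.b ≠ t.c := by
  have := Real.goldenRatio_pos
  obtain ⟨_ | _ | _ | _, a, b, c⟩ := t <;> obtain ⟨h₀, h₁, h₂⟩ := ht
  · exact dist_pos.1 (h₂ ▸ by positivity)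
  · exact dist_pos.1 (h₁ ▸ h₀)
  · exact dist_pos.1 h₀
  · exact dist_pos.1 (h₂ ▸ by positivity)

namespace IsPartner

variable {t t' t₁ t₂ : HalfTile}

theorem dist_eq (h : IsPartner t t') (ht : t.IsWellShaped) (ht' : t'.IsWellShaped) :
    dist t'.a t.b = dist t.a t.b ∧ dist t'.a t.c = dist t.a t.c := by
  obtain ⟨k, a, b, c⟩ := t
  obtain ⟨k', a', b', c'⟩ := t'
  obtain ⟨-, hk, hb, hc⟩ := h
  dsimp only at hk hb hc ⊢
  subst hk hb hc
  have := Real.goldenRatio_ne_zero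
  cases k' <;> simp_all [HalfTile.IsWellShaped, dist_comm]

theorem volume_real_region_eq (h : IsPartner t t') (ht : t.IsWellShaped)
    (ht' : t'.IsWellShaped) : volume.real t'.region = volume.real t.region := by
  obtain ⟨dist_b, dist_c⟩ := h.dist_eq ht ht'
  rw [HalfTile.region, h.b_eq, h.c_eq]
  exact volume_real_triangle_congr dist_b dist_c rfl

theorem a_ne (h : IsPartner t t') : t.a ≠ t'.a := fun ha =>
  h.ne (HalfTile.ext h.kind_eq.symm ha h.b_eq.symm h.c_eq.symm)

theorem unique (h₁ : IsPartner t t₁) (h₂ : IsPartner t t₂) (ht : t.IsWellShaped)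
    (ht₁ : t₁.IsWellShaped) (ht₂ : t₂.IsWellShaped) : t₁ = t₂ := by
  obtain ⟨dist_b₁, dist_c₁⟩ := h₁.dist_eq ht ht₁
  obtain ⟨dist_b₂, dist_c₂⟩ := h₂.dist_eq ht ht₂
  -- Two circles with distinct centres meet in at most two points.
  have ha : t₂.a = t.a ∨ t₂.a = t₁.a :=
    EuclideanGeometry.eq_of_dist_eq_of_dist_eq_of_finrank_eq_two finrank_euclideanSpace_fin
      ht.b_ne_c h₁.a_ne rfl dist_b₁ dist_b₂ rfl dist_c₁ dist_c₂
  exact HalfTile.ext (h₁.kind_eq.trans h₂.kind_eq.symm) (ha.resolve_left h₂.a_ne.symm).symm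
    (h₁.b_eq.trans h₂.b_eq.symm) (h₁.c_eq.trans h₂.c_eq.symm)

end IsPartner

namespace IsHalfTileTiling

variable {σ : Set HalfTile} {t t' : HalfTile} {x : Plane}

theorem exists_patch_isPartner (hσ : IsHalfTileTiling σ) (ht : t ∈ σ) (P : Finset σ) :
    ∃ n T, (∀ s ∈ P, GoldenTriangle.IsLeaf n T s) ∧
      ∃ t', GoldenTriangle.IsLeaf n T t' ∧ IsPartner t t' := by
  classical
  obtain ⟨Q, hQ⟩ := hσ.exists_finset_ball_subset (‖t.b‖ + 1)
  obtain ⟨n, T, h⟩ := hσ.exists_patch (insert ⟨t, ht⟩ (P ∪ Q))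
  have ball_subset := hQ n T fun s hs =>
    h s (Finset.mem_insert_of_mem (Finset.mem_union_right _ hs))
  have hb : t.b ∈ interior T.region := interior_maximal ball_subset Metric.isOpen_ball (by simp)
  exact ⟨n, T, fun s hs => h s (Finset.mem_insert_of_mem (Finset.mem_union_left _ hs)),
    (h _ (Finset.mem_insert_self _ _)).exists_isPartner hb⟩

theorem exists_isPartner (hσ : IsHalfTileTiling σ) (ht : t ∈ σ) : ∃ t' ∈ σ, IsPartner t t' := by
  obtain ⟨n₁, T₁, -, t₁, hleaf₁, hpartner₁⟩ := hσ.exists_patch_isPartner ht ∅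
  -- `t₁` need not be in `σ` a priori, but some `s ∈ σ` overlaps it.
  obtain ⟨y, hy, s, hs, hys⟩ := (Measure.dense_of_ae hσ.ae_mem_interior).inter_open_nonempty _
    isOpen_interior hleaf₁.interior_region_nonempty
  obtain ⟨n₂, T₂, hpatch, t₂, hleaf₂, hpartner₂⟩ := hσ.exists_patch_isPartner ht {⟨s, hs⟩}
  obtain rfl : t₁ = t₂ := hpartner₁.unique hpartner₂ (hσ.isWellShaped ht) hleaf₁.isWellShaped
    hleaf₂.isWellShaped
  obtain rfl : s = t₁ := by_contra fun hne => Set.disjoint_left.1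
    ((hpatch _ (Finset.mem_singleton_self _)).disjoint_interior hleaf₂ hne) hys hy
  exact ⟨s, hs, hpartner₂⟩

theorem volume_real_union_region (hσ : IsHalfTileTiling σ) (ht : t ∈ σ) (ht' : t' ∈ σ)
    (h : IsPartner t t') : volume.real (t.region ∪ t'.region) = 2 * volume.real t.region := by
  have aedisjoint : AEDisjoint volume t.region t'.region :=
    measure_mono_null (show t.region ∩ t'.region ⊆ frontier t.region from fun x hx =>
      ⟨subset_closure hx.1, fun hxt => h.ne (hσ.eq_of_mem ht ht' hxt hx.2)⟩)
      (frontier_region_null t)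
  have isCompact (s : HalfTile) : IsCompact s.region := isCompact_triangle s.a s.b s.c
  rw [measureReal_union₀ (isCompact t').measurableSet.nullMeasurableSet aedisjoint
    (isCompact t).measure_lt_top.ne (isCompact t').measure_lt_top.ne,
    h.volume_real_region_eq (hσ.isWellShaped ht) (hσ.isWellShaped ht'), two_mul]

theorem tilingFun_wholeTiles (hσ : IsHalfTileTiling σ) (ht : t ∈ σ)
    (hx : x ∈ interior t.region) :
    tilingFun (wholeTiles σ) x = 1 / (2 * volume.real t.region) := by
  obtain ⟨t', ht', h⟩ := hσ.exists_isPartner ht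
  refine tilingFun_eq_of_forall ⟨t.region ∪ t'.region, ⟨t, ht, t', ht', h.ne, h.kind_eq.symm,
    h.b_eq.symm, h.c_eq.symm, rfl⟩, interior_mono Set.subset_union_left hx⟩ ?_
  rintro _ ⟨p, hp, q, hq, hne, hk, hb, hc, rfl⟩ hx'
  have hpq : IsPartner p q := ⟨hne, hk.symm, hb.symm, hc.symm⟩
  rw [hσ.volume_real_union_region hp hq hpq]
  obtain hxp | hxq := interior_subset hx'
  · rw [hσ.eq_of_mem ht hp hx hxp]
  · rw [hσ.eq_of_mem ht hq hx hxq,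
      hpq.volume_real_region_eq (hσ.isWellShaped hp) (hσ.isWellShaped hq)]

end IsHalfTileTiling

theorem IsPenroseTiling.exists_tilingFun_eq {τ : Set (Set Plane)} (hτ : IsPenroseTiling τ) :
    ∃ σ, IsHalfTileTiling σ ∧ ∃ c > 0, ∀ t ∈ σ, ∀ x ∈ interior t.region,
      tilingFun τ x = 1 / (c * volume.real t.region) := by
  obtain ⟨σ, hσ, rfl | rfl⟩ := hτ
  · exact ⟨σ, hσ, 2, two_pos, fun t ht x hx => hσ.tilingFun_wholeTiles ht hx⟩
  · exact ⟨σ, hσ, 1, one_pos, fun t ht x hx => by rw [one_mul, hσ.tilingFun_triangles ht hx]⟩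

end WholeTiles

end Penrose

end

theorem corollary1p5 (τ : Set (Set Penrose.Plane)) (hτ : Penrose.IsPenroseTiling τ) :
    ∃ φ : Penrose.Plane ≃ₜ Penrose.Plane,
      (∃ K : NNReal, LipschitzWith K φ ∧ LipschitzWith K φ.symm) ∧
      ∀ᵐ x ∂(MeasureTheory.volume : MeasureTheory.Measure Penrose.Plane),
        DifferentiableAt ℝ φ x ∧ (fderiv ℝ φ x).det = Penrose.tilingFun τ x := by
  obtain ⟨σ, hσ, c, hc, tilingFun_eq⟩ := hτ.exists_tilingFun_eq
  obtain ⟨Φ, hΦ, affine⟩ := hσ.exists_homeomorph hc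
  refine ⟨Φ, hΦ, ?_⟩
  filter_upwards [hσ.ae_mem_interior] with x ⟨t, ht, hx⟩
  rw [tilingFun_eq t ht x hx]
  exact (affine t ht).differentiableAt_and_det_fderiv hx
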